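/- A \emph{length function} on a locally compact (Hausdorff) group $G$ is a function $\ell\colon G\to[0,\infty)$ that is bounded on compact subsets and satisfies $\ell(g^{-1})=\ell(g)$ and $\ell(gh)\le \ell(g)+\ell(h)$ for all $g,h\in G$. Fix a left Haar measure $dg$ on $G$. For a strongly continuous representation $\pi$ of $G$ by bounded operators on a complex Hilbert space and $f\in C_c(G)$, let $\pi(f)$ be the operator $x\mapsto\int f(g)\,\pi(g)x\,dg$. For a length function $\ell$, let $\mathcal C_\ell(G)$ be the Banach algebra obtained by completing the convolution algebra $C_c(G)$ for the norm $\|f\|_\ell=\sup_\pi\|\pi(f)\|$, where the supremum is over all strongly continuous representations $\pi$ of $G$ on a Hilbert space such that $\|\pi(g)\|\le e^{\ell(g)}$ for every $g\in G$; every such $\pi$ extends to $\mathcal C_\ell(G)$. A \emph{Kazhdan projection} in $\mathcal C_{\ell}(G)$ is an idempotent $P\in\mathcal C_\ell(G)$ such that, for every such $\pi$, $\pi(P)$ is a projection onto the space of $\pi(G)$-invariant vectors. The group $G$ has \emph{strong property (T)} if for every length function $\ell$ on $G$ there exists $s>0$ such that for every $c\ge 0$ the Banach algebra $\mathcal C_{s\ell+c}(G)$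 has a Kazhdan projection. Let $\Gamma$ be a lattice in a locally compact group $G$, that is, a discrete subgroup such that $G/\Gamma$ carries a $G$-invariant regular Borel probability measure. If $G$ does not have strong property (T), then $\Gamma$ (as a discrete group) does not have strong property (T) either. -/

import Mathlib

noncomputable section

open MeasureTheory MeasureTheory.Measure
open scoped NNReal CompactlySupported

set_option linter.unusedSectionVars false

namespace StrongT

universe u

/-- A length function on a topological group: a nonnegative, symmetric, subadditive function that
is bounded on compact subsets (no continuity, measurability or properness is required). -/
structure LengthFunction (G : Type u) [Group G] [TopologicalSpace G] where
  toFun : G → ℝ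
  nonneg : ∀ g, 0 ≤ toFun g
  bddAbove_image : ∀ K : Set G, IsCompact K → BddAbove (toFun '' K)
  inv : ∀ g, toFun g⁻¹ = toFun g
  mul_le : ∀ g h, toFun (g * h) ≤ toFun g + toFun h

namespace LengthFunction

variable {G : Type u} [Group G] [TopologicalSpace G]

instance : CoeFun (LengthFunction G) fun _ => G → ℝ := ⟨LengthFunction.toFun⟩

/-- The length function `s ℓ + c`, for `s, c ≥ 0`. -/
def scaleAdd (s c : ℝ≥0) (ℓ : LengthFunction G) : LengthFunction G where
  toFun g := s * ℓ g + c
  nonneg g := by have := ℓ.nonneg g; positivity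
  bddAbove_image K hK := by
    obtain ⟨M, hM⟩ := ℓ.bddAbove_image K hK
    refine ⟨s * M + c, ?_⟩
    rintro _ ⟨g, hg, rfl⟩
    have : ℓ g ≤ M := hM ⟨g, hg, rfl⟩
    dsimp only
    gcongr
  inv g := by rw [ℓ.inv]
  mul_le g h := by
    have h1 := mul_le_mul_of_nonneg_left (ℓ.mul_le g h) s.coe_nonneg
    have h2 := c.coe_nonneg
    linarith

end LengthFunction

/-- A strongly continuous representation `π` of `G` by bounded operators on a complex Hilbert space,
with `‖π g‖ ≤ exp (ℓ g)` for all `g`. The Hilbert space lives in the universe of `G`; this is no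
restriction, because every vector of a strongly continuous representation lies in a closed
invariant subspace with a dense subset indexed by finitely supported functions on `G`. -/
structure HilbertRep {G : Type u} [Group G] [TopologicalSpace G] (ℓ : LengthFunction G) where
  H : Type u
  [normed : NormedAddCommGroup H]
  [inner : InnerProductSpace ℂ H]
  [complete : CompleteSpace H]
  toHom : G →* (H →L[ℂ] H)
  continuous_apply : ∀ x : H, Continuous fun g => toHom g x
  norm_le : ∀ g, ‖toHom g‖ ≤ Real.exp (ℓ g)

attribute [instance] HilbertRep.normed HilbertRep.inner HilbertRep.complete

variable {G : Type u} [Group G] [TopologicalSpace G] [IsTopologicalGroup G]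
  [LocallyCompactSpace G] [MeasurableSpace G] [BorelSpace G]

/-! ### Convolution on `C_c(G)` with respect to left Haar measure -/

theorem integrable_smul {E : Type*} [NormedAddCommGroup E] [NormedSpace ℂ E]
    (f : C_c(G, ℂ)) {φ : G → E} (hφ : Continuous φ) :
    Integrable (fun g => f g • φ g) (haar : Measure G) :=
  (f.continuous.smul hφ).integrable_of_hasCompactSupport f.hasCompactSupport.smul_right

theorem continuous_conv (f g : C_c(G, ℂ)) :
    Continuous fun x => ∫ y, f y * g (y⁻¹ * x) ∂(haar : Measure G) := by
  apply continuous_iff_continuousAt.2 (fun x₀ ↦ ?_)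
  obtain ⟨t, t_comp, ht⟩ := exists_compact_mem_nhds x₀
  have A : ContinuousOn (fun x : G ↦ ∫ y, f y * g (y⁻¹ * x) ∂(haar : Measure G)) t := by
    apply continuousOn_integral_of_compact_support (k := tsupport f) f.hasCompactSupport
    · exact ((f.continuous.comp continuous_snd).mul
        (g.continuous.comp (continuous_snd.inv.mul continuous_fst))).continuousOn
    · intro p x _ hx
      rw [image_eq_zero_of_notMem_tsupport hx, zero_mul]
  exact A.continuousAt ht

theorem hasCompactSupport_conv (f g : C_c(G, ℂ)) :
    HasCompactSupport fun x => ∫ y, f y * g (y⁻¹ * x) ∂(haar : Measure G) := by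
  have hK : IsCompact ((fun p : G × G => p.1 * p.2) '' (tsupport f ×ˢ tsupport g)) :=
    (f.hasCompactSupport.isCompact.prod g.hasCompactSupport.isCompact).image continuous_mul
  refine HasCompactSupport.intro hK fun x hx => ?_
  rw [← integral_zero G ℂ (μ := haar)]
  congr 1 with y
  by_contra hne
  refine hx ⟨(y, y⁻¹ * x), ⟨subset_tsupport _ ?_, subset_tsupport _ ?_⟩, by simp⟩
  · exact left_ne_zero_of_mul hne
  · exact right_ne_zero_of_mul hne

/-- The convolution `(f * g)(x) = ∫ f(y) g(y⁻¹ x) dy`. -/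
def conv (f g : C_c(G, ℂ)) : C_c(G, ℂ) where
  toFun x := ∫ y, f y * g (y⁻¹ * x) ∂(haar : Measure G)
  continuous_toFun := continuous_conv f g
  hasCompactSupport' := hasCompactSupport_conv f g

theorem conv_apply (f g : C_c(G, ℂ)) (x : G) :
    conv f g x = ∫ y, f y * g (y⁻¹ * x) ∂(haar : Measure G) := rfl

theorem integral_conv_smul {E : Type*} [NormedAddCommGroup E] [NormedSpace ℂ E] [CompleteSpace E]
    (f g : C_c(G, ℂ)) {φ : G → E} (hφ : Continuous φ) :
    ∫ s, conv f g s • φ s ∂(haar : Measure G) =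
      ∫ t, f t • ∫ s, g s • φ (t * s) ∂(haar : Measure G) ∂(haar : Measure G) := by
  have h1 : ∀ s, conv f g s • φ s = ∫ t, (f t * g (t⁻¹ * s)) • φ s ∂(haar : Measure G) := by
    intro s
    rw [conv_apply, integral_smul_const]
  simp_rw [h1]
  rw [integral_integral_swap_of_hasCompactSupport]
  · congr 1 with t
    simp_rw [mul_smul]
    rw [integral_smul, ← integral_mul_left_eq_self _ t]
    simp
  · exact ((f.continuous.comp continuous_snd).mul (g.continuous.comp
      (continuous_snd.inv.mul continuous_fst))).smul (hφ.comp continuous_fst)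
  · have hK : IsCompact ((fun p : G × G => (p.1 * p.2, p.1)) '' (tsupport f ×ˢ tsupport g)) :=
      (f.hasCompactSupport.isCompact.prod g.hasCompactSupport.isCompact).image
        (continuous_mul.prodMk continuous_fst)
    refine HasCompactSupport.intro hK ?_
    rintro ⟨s, t⟩ hx
    by_contra hne
    have hne' := left_ne_zero_of_smul hne
    refine hx ⟨(t, t⁻¹ * s), ⟨subset_tsupport _ ?_, subset_tsupport _ ?_⟩, by simp⟩
    · exact left_ne_zero_of_mul hne'
    · exact right_ne_zero_of_mul hne'

/-! ### The integrated form of a representation -/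

namespace HilbertRep

variable {ℓ : LengthFunction G} (π : HilbertRep ℓ)

theorem exists_bound (ℓ : LengthFunction G) (f : C_c(G, ℂ)) : ∃ C : ℝ, 0 ≤ C ∧
    ∀ (π : HilbertRep ℓ) (x : π.H),
      ‖∫ g, f g • π.toHom g x ∂(haar : Measure G)‖ ≤ C * ‖x‖ := by
  obtain ⟨M, hM⟩ := ℓ.bddAbove_image _ f.hasCompactSupport.isCompact
  refine ⟨(∫ g, ‖f g‖ ∂(haar : Measure G)) * Real.exp M, by positivity, fun π x => ?_⟩
  have hf : Integrable (fun g => ‖f g‖) (haar : Measure G) :=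
    (f.continuous.integrable_of_hasCompactSupport f.hasCompactSupport).norm
  calc ‖∫ g, f g • π.toHom g x ∂(haar : Measure G)‖
      ≤ ∫ g, ‖f g‖ * (Real.exp M * ‖x‖) ∂(haar : Measure G) := by
        refine norm_integral_le_of_norm_le (hf.mul_const _) (ae_of_all _ fun g => ?_)
        rw [norm_smul]
        by_cases hg : g ∈ tsupport f
        · have h1 : ℓ g ≤ M := hM ⟨g, hg, rfl⟩
          have h2 := (π.toHom g).le_of_opNorm_le (π.norm_le g) x
          have h3 := Real.exp_le_exp.2 h1
          gcongr
          exact h2.trans (by gcongr)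
        · simp [image_eq_zero_of_notMem_tsupport hg]
    _ = (∫ g, ‖f g‖ ∂(haar : Measure G)) * Real.exp M * ‖x‖ := by
        rw [integral_mul_const, mul_assoc]

/-- The operator `π(f) = ∫ f(g) π(g) dg`, defined pointwise by a Bochner integral. -/
def opOf (f : C_c(G, ℂ)) : π.H →L[ℂ] π.H :=
  LinearMap.mkContinuousOfExistsBound
    { toFun := fun x => ∫ g, f g • π.toHom g x ∂(haar : Measure G)
      map_add' := fun x y => by
        rw [← integral_add (integrable_smul f (π.continuous_apply x))
          (integrable_smul f (π.continuous_apply y))]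
        simp_rw [map_add, smul_add]
      map_smul' := fun c x => by
        rw [RingHom.id_apply, ← integral_smul]
        simp_rw [map_smul, smul_comm c] }
    (let ⟨C, _, h⟩ := exists_bound ℓ f; ⟨C, fun x => h π x⟩)

theorem opOf_apply (f : C_c(G, ℂ)) (x : π.H) :
    π.opOf f x = ∫ g, f g • π.toHom g x ∂(haar : Measure G) := rfl

theorem opOf_add (f g : C_c(G, ℂ)) : π.opOf (f + g) = π.opOf f + π.opOf g := by
  ext x
  rw [_root_.add_apply, opOf_apply, opOf_apply, opOf_apply,
    ← integral_add (integrable_smul f (π.continuous_apply x))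
      (integrable_smul g (π.continuous_apply x))]
  simp_rw [CompactlySupportedContinuousMap.add_apply, add_smul]

theorem opOf_smul (c : ℂ) (f : C_c(G, ℂ)) : π.opOf (c • f) = c • π.opOf f := by
  ext x
  rw [_root_.smul_apply, opOf_apply, opOf_apply, ← integral_smul]
  simp_rw [CompactlySupportedContinuousMap.smul_apply, smul_assoc]

theorem opOf_conv (f g : C_c(G, ℂ)) : π.opOf (conv f g) = π.opOf f * π.opOf g := by
  ext x
  rw [mul_apply_eq_comp, opOf_apply, integral_conv_smul f g (π.continuous_apply x),
    opOf_apply]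
  congr 1 with t
  rw [opOf_apply, ← ContinuousLinearMap.integral_comp_comm _
    (integrable_smul g (π.continuous_apply x))]
  simp_rw [map_mul, map_smul, mul_apply_eq_comp]

theorem bddAbove_norm_opOf (ℓ : LengthFunction G) (f : C_c(G, ℂ)) :
    BddAbove (Set.range fun π : HilbertRep ℓ => ‖π.opOf f‖) := by
  obtain ⟨C, hC, h⟩ := exists_bound ℓ f
  refine ⟨C, ?_⟩
  rintro _ ⟨π, rfl⟩
  exact ContinuousLinearMap.opNorm_le_bound _ hC (h π)

end HilbertRep

/-! ### The Banach algebra `C_ℓ(G)` -/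

/-- The space `C_c(G)`, to be equipped with convolution and the norm `‖·‖_ℓ`. -/
def ConvAlg (_ℓ : LengthFunction G) : Type u := C_c(G, ℂ)

namespace ConvAlg

variable {ℓ : LengthFunction G}

instance : AddCommGroup (ConvAlg ℓ) := inferInstanceAs (AddCommGroup C_c(G, ℂ))

instance : Module ℂ (ConvAlg ℓ) := inferInstanceAs (Module ℂ C_c(G, ℂ))

/-- A function in `C_c(G)`, viewed as an element of the convolution algebra. -/
def of (ℓ : LengthFunction G) : C_c(G, ℂ) ≃ₗ[ℂ] ConvAlg ℓ := LinearEquiv.refl ℂ C_c(G, ℂ)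

/-- The map `f ↦ π(f)` on `C_c(G)`. -/
def rep (π : HilbertRep ℓ) : ConvAlg ℓ →ₗ[ℂ] (π.H →L[ℂ] π.H) where
  toFun f := π.opOf ((of ℓ).symm f)
  map_add' _ _ := π.opOf_add _ _
  map_smul' _ _ := π.opOf_smul _ _

instance : Mul (ConvAlg ℓ) := ⟨fun f g => of ℓ (conv ((of ℓ).symm f) ((of ℓ).symm g))⟩

theorem rep_mul (π : HilbertRep ℓ) (f g : ConvAlg ℓ) : rep π (f * g) = rep π f * rep π g :=
  π.opOf_conv _ _

theorem bddAbove_norm_rep (f : ConvAlg ℓ) :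
    BddAbove (Set.range fun π : HilbertRep ℓ => ‖rep π f‖) :=
  HilbertRep.bddAbove_norm_opOf ℓ _

/-- The norm `‖f‖_ℓ = sup_π ‖π(f)‖`, over all strongly continuous representations `π` on Hilbert
spaces with `‖π(g)‖ ≤ exp (ℓ g)`. -/
instance : Norm (ConvAlg ℓ) := ⟨fun f => ⨆ π : HilbertRep ℓ, ‖rep π f‖⟩

theorem norm_def (f : ConvAlg ℓ) : ‖f‖ = ⨆ π : HilbertRep ℓ, ‖rep π f‖ := rfl

theorem norm_rep_le (π : HilbertRep ℓ) (f : ConvAlg ℓ) : ‖rep π f‖ ≤ ‖f‖ :=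
  le_ciSup (bddAbove_norm_rep f) π

theorem norm_nonneg' (f : ConvAlg ℓ) : 0 ≤ ‖f‖ := Real.iSup_nonneg fun _ => norm_nonneg _

theorem norm_le_of {f : ConvAlg ℓ} {C : ℝ} (hC : 0 ≤ C) (h : ∀ π, ‖rep π f‖ ≤ C) : ‖f‖ ≤ C :=
  Real.iSup_le h hC

theorem ext_apply {f g : ConvAlg ℓ} (h : ∀ x, (of ℓ).symm f x = (of ℓ).symm g x) : f = g :=
  (of ℓ).symm.injective (CompactlySupportedContinuousMap.ext h)

theorem mul_apply (f g : ConvAlg ℓ) (x : G) : (of ℓ).symm (f * g) x =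
    ∫ y, (of ℓ).symm f y • (of ℓ).symm g (y⁻¹ * x) ∂(haar : Measure G) := rfl

theorem add_apply (f g : ConvAlg ℓ) (x : G) :
    (of ℓ).symm (f + g) x = (of ℓ).symm f x + (of ℓ).symm g x := rfl

theorem integrable_mul (f g : ConvAlg ℓ) (x : G) : Integrable
    (fun y => (of ℓ).symm f y • (of ℓ).symm g (y⁻¹ * x)) (haar : Measure G) :=
  integrable_smul _ (((of ℓ).symm g).continuous.comp (continuous_inv.mul continuous_const))

instance : NonUnitalRing (ConvAlg ℓ) where
  left_distrib f g h := ext_apply fun x => by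
    simp_rw [add_apply, mul_apply]
    rw [← integral_add (integrable_mul f g x) (integrable_mul f h x)]
    simp_rw [add_apply, smul_add]
  right_distrib f g h := ext_apply fun x => by
    simp_rw [add_apply, mul_apply]
    rw [← integral_add (integrable_mul f h x) (integrable_mul g h x)]
    simp_rw [add_apply, add_smul]
  zero_mul f := ext_apply fun x => by simp [mul_apply]
  mul_zero f := ext_apply fun x => by simp [mul_apply]
  mul_assoc f g h := ext_apply fun x => by
    have := integral_conv_smul ((of ℓ).symm f) ((of ℓ).symm g)
      (φ := fun s => (of ℓ).symm h (s⁻¹ * x))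
      (((of ℓ).symm h).continuous.comp (continuous_inv.mul continuous_const))
    refine this.trans ?_
    rw [mul_apply]
    simp_rw [mul_apply, mul_inv_rev, mul_assoc]

instance : NonUnitalSeminormedRing (ConvAlg ℓ) where
  __ := AddGroupSeminorm.toSeminormedAddCommGroup
    { toFun := fun f : ConvAlg ℓ => ‖f‖
      map_zero' := by simp [norm_def]
      add_le' := fun f g => norm_le_of (add_nonneg (norm_nonneg' _) (norm_nonneg' _)) fun π => by
        rw [map_add]
        exact (norm_add_le _ _).trans (add_le_add (norm_rep_le π f) (norm_rep_le π g))
      neg' := fun f => by simp [norm_def] }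
  __ := (inferInstance : NonUnitalRing (ConvAlg ℓ))
  norm_mul_le f g := norm_le_of (mul_nonneg (norm_nonneg' _) (norm_nonneg' _)) fun π => by
    rw [rep_mul]
    exact (norm_mul_le _ _).trans
      (mul_le_mul (norm_rep_le π f) (norm_rep_le π g) (norm_nonneg _) (norm_nonneg' _))

instance : NormedSpace ℂ (ConvAlg ℓ) where
  norm_smul_le c f := norm_le_of (mul_nonneg (norm_nonneg c) (norm_nonneg' _)) fun π => by
    rw [map_smul, norm_smul]
    exact mul_le_mul_of_nonneg_left (norm_rep_le π f) (norm_nonneg c)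

/-- The map `f ↦ π(f)`, as a bounded operator for the norm `‖·‖_ℓ`. -/
def repL (π : HilbertRep ℓ) : ConvAlg ℓ →L[ℂ] (π.H →L[ℂ] π.H) :=
  (rep π).mkContinuous 1 fun f => by rw [one_mul]; exact norm_rep_le π f

end ConvAlg

/-- `C_ℓ(G)`: the completion of the convolution algebra `C_c(G)` for the norm `‖·‖_ℓ`. -/
abbrev CAlg (ℓ : LengthFunction G) : Type u := UniformSpace.Completion (ConvAlg ℓ)

namespace CAlg

open UniformSpace UniformSpace.Completion

variable {ℓ : LengthFunction G}

/-- The product of `C_ℓ(G)`: the continuous extension of convolution. -/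
instance : Mul (CAlg ℓ) :=
  ⟨fun a b => (isDenseInducing_coe.prodMap isDenseInducing_coe).extend
    (fun p : ConvAlg ℓ × ConvAlg ℓ => ((p.1 * p.2 : ConvAlg ℓ) : CAlg ℓ)) (a, b)⟩

theorem coe_mul (f g : ConvAlg ℓ) : ((f * g : ConvAlg ℓ) : CAlg ℓ) = (f : CAlg ℓ) * (g : CAlg ℓ) :=
  ((isDenseInducing_coe.prodMap isDenseInducing_coe).extend_eq
    ((continuous_coe (ConvAlg ℓ)).comp continuous_mul) (f, g)).symm

instance : ContinuousMul (CAlg ℓ) where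
  continuous_mul := by
    let m := (AddMonoidHom.mul : ConvAlg ℓ →+ ConvAlg ℓ →+ ConvAlg ℓ).compr₂ toCompl
    have : Continuous fun p : ConvAlg ℓ × ConvAlg ℓ => m p.1 p.2 :=
      (continuous_coe (ConvAlg ℓ)).comp continuous_mul
    have di : IsDenseInducing (toCompl : ConvAlg ℓ → CAlg ℓ) := isDenseInducing_coe
    exact (di.extend_Z_bilin di this :)

instance : NonUnitalNormedRing (CAlg ℓ) where
  __ := (inferInstance : NormedAddCommGroup (CAlg ℓ))
  __ := (inferInstance : Mul (CAlg ℓ))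
  zero_mul a := Completion.induction_on a (isClosed_eq (by fun_prop) continuous_const)
    fun a => by rw [← Completion.coe_zero, ← coe_mul, zero_mul]
  mul_zero a := Completion.induction_on a (isClosed_eq (by fun_prop) continuous_const)
    fun a => by rw [← Completion.coe_zero, ← coe_mul, mul_zero]
  mul_assoc a b c := Completion.induction_on₃ a b c (isClosed_eq (by fun_prop) (by fun_prop))
    fun a b c => by rw [← coe_mul, ← coe_mul, ← coe_mul, ← coe_mul, mul_assoc]
  left_distrib a b c := Completion.induction_on₃ a b c (isClosed_eq (by fun_prop) (by fun_prop))
    fun a b c => by rw [← Completion.coe_add, ← coe_mul, ← coe_mul, ← coe_mul, ← Completion.coe_add, mul_add]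
  right_distrib a b c := Completion.induction_on₃ a b c (isClosed_eq (by fun_prop) (by fun_prop))
    fun a b c => by rw [← Completion.coe_add, ← coe_mul, ← coe_mul, ← coe_mul, ← Completion.coe_add, add_mul]
  norm_mul_le a b := Completion.induction_on₂ a b (isClosed_le (by fun_prop) (by fun_prop))
    fun a b => by
      rw [← coe_mul, norm_coe, norm_coe, norm_coe]
      exact norm_mul_le a b

/-- The extension of a representation `π` with `‖π(g)‖ ≤ exp (ℓ g)` to `C_ℓ(G)`. -/
def rep (π : HilbertRep ℓ) : CAlg ℓ →L[ℂ] (π.H →L[ℂ] π.H) :=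
  (ConvAlg.repL π).extend (toComplL : ConvAlg ℓ →L[ℂ] CAlg ℓ)

theorem rep_coe (π : HilbertRep ℓ) (f : ConvAlg ℓ) : rep π (f : CAlg ℓ) = ConvAlg.rep π f :=
  ContinuousLinearMap.extend_eq _ denseRange_coe (isUniformInducing_coe _) f

end CAlg

/-- A Kazhdan projection in `C_ℓ(G)`: an idempotent `P` such that, for every strongly continuous
representation `π` of `G` on a Hilbert space with `‖π(g)‖ ≤ exp (ℓ g)`, the operator `π(P)` is a
projection whose range is the space of `π(G)`-invariant vectors. -/
structure IsKazhdanProjection {ℓ : LengthFunction G} (P : CAlg ℓ) : Prop where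
  isIdempotent : P * P = P
  isIdempotent_rep : ∀ π : HilbertRep ℓ, CAlg.rep π P * CAlg.rep π P = CAlg.rep π P
  range_rep : ∀ π : HilbertRep ℓ, Set.range (CAlg.rep π P) = {x | ∀ g, π.toHom g x = x}

/-- Strong property (T): for every length function `ℓ` there is `s > 0` such that for every `c ≥ 0`
the Banach algebra `C_{sℓ+c}(G)` has a Kazhdan projection. -/
def HasStrongPropertyT (G : Type u) [Group G] [TopologicalSpace G] [IsTopologicalGroup G]
    [LocallyCompactSpace G] [MeasurableSpace G] [BorelSpace G] : Prop :=
  ∀ ℓ : LengthFunction G, ∃ s : ℝ≥0, 0 < s ∧ ∀ c : ℝ≥0,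
    ∃ P : CAlg (ℓ.scaleAdd s c), IsKazhdanProjection P

/-- A lattice: a discrete subgroup `Γ` such that `G ⧸ Γ` carries a `G`-invariant (regular) Borel
probability measure. -/
class IsLattice {G : Type u} [Group G] [TopologicalSpace G] (Γ : Subgroup G) : Prop where
  discrete : DiscreteTopology Γ
  exists_measure : ∃ μ : @Measure (G ⧸ Γ) (borel (G ⧸ Γ)),
    @IsProbabilityMeasure (G ⧸ Γ) (borel (G ⧸ Γ)) μ ∧ @Measure.Regular (G ⧸ Γ) (borel (G ⧸ Γ)) _ μ ∧
      ∀ (g : G) (A : Set (G ⧸ Γ)), MeasurableSet[borel (G ⧸ Γ)] A → μ ((g • ·) ⁻¹' A) = μ A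

instance {G : Type u} [Group G] [TopologicalSpace G] (Γ : Subgroup G) [IsLattice Γ] :
    DiscreteTopology Γ :=
  IsLattice.discrete

end StrongT

end

/-!
Let `Γ` be a lattice in `G`, let `μ` be the invariant probability measure on `G ⧸ Γ`, and suppose
that `Γ` has strong property (T). If `P` is a Kazhdan projection for `Γ` and `π` is a representation
of `G`, then `g ↦ π(g) π(P)` factors through `G ⧸ Γ`, and its mean `∫ π(g) π(P) dμ(gΓ)`, if it
converges, is a projection onto the `G`-invariant vectors. If the growth of `π` is dominated by an
integrable weight on `G ⧸ Γ`, these means are limits of operators `π(h) π(f)`, with `h ∈ C_c(G)` and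
`f` finitely supported on `Γ`, uniformly in `π`; they therefore come from a Kazhdan projection for
`G`. This is `exists_isKazhdanProjection_of_lattice`. The passage between `G` and `G ⧸ Γ` is Weil's
formula (`exists_isWeilConstant`), a consequence of the uniqueness of Haar measure.

It remains to make `exp (s ℓ + c)` integrable over `G ⧸ Γ` for a small `s` that does not depend on
`c`. For unitary representations no growth condition is needed, so `G` has a Kazhdan projection for
these. On `L²(G ⧸ Γ)` it acts as the mean, because the action of `G` on `G ⧸ Γ` is ergodic. Hence some
`f ∈ C_c(G)` acts on the functions of mean zero in `L²(G ⧸ Γ)` with norm at most `1 / 4`, and on the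
constants by a scalar of modulus at least `3 / 4`. Applying `f` repeatedly spreads the indicator
function of a compact set `A` exponentially fast over `G ⧸ Γ`, so the translates of `A` by products
of `m` elements of the support of `f` cover `G ⧸ Γ` up to a set of measure `O(3⁻ᵐ)`
(`IsKazhdanProjection.exists_measure_compl_le`). As `ℓ` grows at most linearly along these
products, `exp (s ℓ + c)` is integrable for small `s` (`IsKazhdanProjection.exists_weight`).
-/

noncomputable section

open MeasureTheory MeasureTheory.Measure
open scoped NNReal CompactlySupported

set_option linter.unusedSectionVars false

namespace StrongT

/-! ### Summation over the cosets of a discrete subgroup -/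

section Periodize

open Set Function Topology Pointwise

variable {G : Type*} [Group G] {E : Type*}

/-- The function `gΓ ↦ ∑ γ ∈ Γ, F (g γ)` on `G ⧸ Γ`. The sum is a `finsum`, so it is meaningful only
if finitely many terms are nonzero, which is the case when `F` has compact support and `Γ` is
discrete and closed. -/
def periodize [AddCommMonoid E] (Γ : Subgroup G) (F : G → E) (x : G ⧸ Γ) : E :=
  ∑ᶠ γ : Γ, F (x.out * γ)

theorem periodize_mk [AddCommMonoid E] (Γ : Subgroup G) (F : G → E) (g : G) :
    periodize Γ F (g : G ⧸ Γ) = ∑ᶠ γ : Γ, F (g * γ) := by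
  obtain ⟨γ₀, h⟩ := QuotientGroup.mk_out_eq_mul Γ g
  rw [periodize, h, ← finsum_comp_equiv (Equiv.mulLeft γ₀) (f := fun γ : Γ => F (g * γ))]
  simp [mul_assoc]

theorem periodize_comp_mul_left [AddCommMonoid E] (Γ : Subgroup G) (F : G → E) (g : G)
    (x : G ⧸ Γ) : periodize Γ (fun y => F (g * y)) x = periodize Γ F (g • x) := by
  induction x using QuotientGroup.induction_on with
  | H x =>
    rw [← MulAction.Quotient.coe_smul_out, periodize, periodize_mk]
    simp [mul_assoc]

theorem periodize_comp_mul_right [AddCommMonoid E] (Γ : Subgroup G) (F : G → E) (γ : Γ) :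
    periodize Γ (fun y => F (y * γ)) = periodize Γ F := by
  funext x
  rw [periodize, periodize, ← finsum_comp_equiv (Equiv.mulRight γ) (f := fun γ : Γ => F (x.out * γ))]
  simp [mul_assoc]

variable [TopologicalSpace G] [IsTopologicalGroup G] [T2Space G] (Γ : Subgroup G)
  [DiscreteTopology Γ]

instance t2Space_quotient : T2Space (G ⧸ Γ) := by
  rw [t2Space_iff_of_isOpenQuotientMap (QuotientGroup.isOpenQuotientMap_mk (N := Γ))]
  simp_rw [QuotientGroup.eq]
  exact (Subgroup.isClosed_of_discrete (H := Γ)).preimage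
    (f := fun q : G × G => q.1⁻¹ * q.2) (by fun_prop)

theorem finite_setOf_coe_mem_of_isCompact {K : Set G} (hK : IsCompact K) :
    {γ : Γ | (γ : G) ∈ K}.Finite :=
  ((Subgroup.isClosed_of_discrete (H := Γ)).isClosedEmbedding_subtypeVal.isCompact_preimage
    hK).finite_of_discrete

variable {F : G → E}

theorem finite_support_comp_mul [Zero E] (hF : HasCompactSupport F) (g : G) :
    (support fun γ : Γ => F (g * γ)).Finite := by
  refine (finite_setOf_coe_mem_of_isCompact Γ (hF.isCompact.smul g⁻¹)).subset fun γ hγ => ?_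
  rw [mem_ofPred_eq, mem_inv_smul_set_iff]
  exact subset_tsupport _ hγ

theorem locallyFinite_support_comp_mul [LocallyCompactSpace G] [Zero E]
    (hF : HasCompactSupport F) : LocallyFinite fun γ : Γ => support fun g => F (g * γ) := by
  intro g
  obtain ⟨U, hU, hg⟩ := exists_compact_mem_nhds g
  refine ⟨U, hg, (finite_setOf_coe_mem_of_isCompact Γ (hU.inv.mul hF.isCompact)).subset ?_⟩
  rintro γ ⟨x, hx, hxU⟩
  exact ⟨x⁻¹, by simpa using hxU, x * γ, subset_tsupport _ hx, by simp⟩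

theorem continuous_periodize [LocallyCompactSpace G] [TopologicalSpace E] [AddCommMonoid E]
    [ContinuousAdd E] (hc : Continuous F) (hF : HasCompactSupport F) :
    Continuous (periodize Γ F) := by
  rw [(QuotientGroup.isQuotientMap_mk Γ).continuous_iff]
  refine (continuous_finsum (fun γ : Γ => ?_) (locallyFinite_support_comp_mul Γ hF)).congr
    fun g => (periodize_mk Γ F g).symm
  fun_prop

theorem periodize_eq_zero [AddCommMonoid E] {x : G ⧸ Γ}
    (hx : x ∉ ((↑) : G → G ⧸ Γ) '' tsupport F) : periodize Γ F x = 0 := by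
  refine finsum_eq_zero_of_forall_eq_zero fun γ => ?_
  by_contra h
  exact hx ⟨_, subset_tsupport _ h, by simp⟩

theorem hasCompactSupport_periodize [LocallyCompactSpace G] [AddCommMonoid E]
    (hF : HasCompactSupport F) : HasCompactSupport (periodize Γ F) :=
  HasCompactSupport.intro (hF.isCompact.image QuotientGroup.continuous_mk)
    fun _ => periodize_eq_zero Γ

theorem periodize_add [AddCommMonoid E] {F' : G → E} (hF : HasCompactSupport F)
    (hF' : HasCompactSupport F') :
    periodize Γ (F + F') = periodize Γ F + periodize Γ F' := by
  funext x
  exact finsum_add_distrib (finite_support_comp_mul Γ hF _) (finite_support_comp_mul Γ hF' _)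

theorem map_periodize {E' : Type*} [AddCommMonoid E] [AddCommMonoid E'] (φ : E →+ E')
    (hF : HasCompactSupport F) (x : G ⧸ Γ) :
    periodize Γ (fun g => φ (F g)) x = φ (periodize Γ F x) :=
  (φ.map_finsum (finite_support_comp_mul Γ hF _)).symm

/-- A function pulled back from `G ⧸ Γ` can be taken out of the sum over `Γ`. -/
theorem periodize_smul [AddCommGroup E] [Module ℝ E] (h : G → ℝ)
    (Φ : G ⧸ Γ → E) (x : G ⧸ Γ) :
    periodize Γ (fun g => h g • Φ g) x = periodize Γ h x • Φ x := by
  induction x using QuotientGroup.induction_on with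
  | H x =>
    rw [periodize_mk, periodize_mk, finsum_smul]
    simp

theorem exists_isCompact_image_mk [LocallyCompactSpace G] {K : Set (G ⧸ Γ)} (hK : IsCompact K) :
    ∃ L : Set G, IsCompact L ∧ K ⊆ ((↑) : G → G ⧸ Γ) '' L := by
  choose U hU hgU using fun g : G => exists_compact_mem_nhds g
  obtain ⟨t, ht⟩ := hK.elim_finite_subcover (fun g : G => ((↑) : G → G ⧸ Γ) '' interior (U g))
    (fun g => QuotientGroup.isOpenMap_coe _ isOpen_interior) fun x _ => by
      induction x using QuotientGroup.induction_on with
      | H x => exact mem_iUnion.2 ⟨x, x, mem_interior_iff_mem_nhds.2 (hgU x), rfl⟩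
  refine ⟨⋃ g ∈ t, U g, t.isCompact_biUnion fun g _ => hU g, fun x hx => ?_⟩
  obtain ⟨g, hg, y, hy, rfl⟩ := mem_iUnion₂.1 (ht hx)
  exact ⟨y, mem_iUnion₂.2 ⟨g, hg, interior_subset hy⟩, rfl⟩

/-- Every compactly supported continuous function on `G ⧸ Γ` is the sum over `Γ` of one on `G`. -/
theorem exists_periodize_eq [LocallyCompactSpace G] {k : G ⧸ Γ → ℝ} (hk : Continuous k)
    (hk' : HasCompactSupport k) :
    ∃ h : G → ℝ, Continuous h ∧ HasCompactSupport h ∧ periodize Γ h = k := by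
  obtain ⟨L, hL, hKL⟩ := exists_isCompact_image_mk Γ hk'.isCompact
  obtain ⟨⟨h₀, hc⟩, h1, -, hs, h01⟩ :=
    exists_continuous_one_zero_of_isCompact hL isClosed_empty (disjoint_empty _)
  simp only [ContinuousMap.coe_mk] at h1 hs h01
  have hcp := continuous_periodize Γ hc hs
  -- `h₀` is normalized by its sum over `Γ`, which is at least `1` on the support of `k`.
  let Φ : G ⧸ Γ → ℝ := fun x => k x / max 1 (periodize Γ h₀ x)
  have hΦ : Continuous Φ := hk.div (continuous_const.max hcp) fun x =>
    (zero_lt_one.trans_le (le_max_left _ _)).ne'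
  refine ⟨fun g => h₀ g • Φ g, hc.smul (hΦ.comp QuotientGroup.continuous_mk), hs.smul_right, ?_⟩
  funext x
  rw [periodize_smul]
  by_cases hx : x ∈ tsupport k
  · obtain ⟨g, hg, rfl⟩ := hKL hx
    have : 1 ≤ periodize Γ h₀ (g : G ⧸ Γ) := by
      rw [periodize_mk]
      refine le_trans ?_ (single_le_finsum (1 : Γ) (finite_support_comp_mul Γ hs g)
        fun γ => (h01 _).1)
      simp [h1 hg]
    simp only [Φ, max_eq_right this, smul_eq_mul]
    field_simp
  · simp [Φ, image_eq_zero_of_notMem_tsupport hx]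

end Periodize

/-! ### Invariant measures on the quotient by a discrete subgroup -/

section Quotient

open Set Function Topology

variable {G : Type*} [Group G] [TopologicalSpace G] [IsTopologicalGroup G] [T2Space G]
  [LocallyCompactSpace G] [MeasurableSpace G] [BorelSpace G] (Γ : Subgroup G) [DiscreteTopology Γ]
  [MeasurableSpace (G ⧸ Γ)] [BorelSpace (G ⧸ Γ)]

theorem integrable_periodize (μ : Measure (G ⧸ Γ)) [IsFiniteMeasureOnCompacts μ] {E : Type*}
    [NormedAddCommGroup E] {F : G → E} (hc : Continuous F) (hs : HasCompactSupport F) :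
    Integrable (periodize Γ F) μ :=
  (continuous_periodize Γ hc hs).integrable_of_hasCompactSupport (hasCompactSupport_periodize Γ hs)

/-- Integration of `periodize Γ F` is a left invariant positive functional of `F`, so uniqueness of
Haar measure makes it a multiple of the Haar integral. -/
theorem exists_integral_periodize_eq_real (μ : Measure (G ⧸ Γ)) [IsFiniteMeasureOnCompacts μ]
    [SMulInvariantMeasure G (G ⧸ Γ) μ] :
    ∃ c : ℝ≥0, ∀ F : G → ℝ, Continuous F → HasCompactSupport F →
      ∫ x, periodize Γ F x ∂μ = c * ∫ g, F g ∂(haar : Measure G) := by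
  let Λ : C_c(G, ℝ) →ₚ[ℝ] ℝ := PositiveLinearMap.mk₀
    { toFun := fun F => ∫ x, periodize Γ F x ∂μ
      map_add' := fun F F' => by
        rw [CompactlySupportedContinuousMap.coe_add,
          periodize_add Γ F.hasCompactSupport F'.hasCompactSupport]
        exact integral_add (integrable_periodize Γ μ F.continuous F.hasCompactSupport)
          (integrable_periodize Γ μ F'.continuous F'.hasCompactSupport)
      map_smul' := fun c F => by
        rw [RingHom.id_apply, ← integral_smul]
        congr 1 with x
        exact map_periodize Γ (DistribSMul.toAddMonoidHom ℝ c) F.hasCompactSupport x }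
    fun F hF => integral_nonneg fun x => finsum_nonneg fun γ => hF _
  have hΛ : ∀ F : C_c(G, ℝ), ∫ g, F g ∂(RealRMK.rieszMeasure Λ) = ∫ x, periodize Γ F x ∂μ :=
    fun F => RealRMK.integral_rieszMeasure Λ F
  have : IsMulLeftInvariant (RealRMK.rieszMeasure Λ) := ⟨fun g => by
    have : (map (g * ·) (RealRMK.rieszMeasure Λ)).Regular :=
      Regular.map (Homeomorph.mulLeft g)
    refine Measure.ext_of_integral_eq_on_compactlySupported fun F => ?_
    have hF : HasCompactSupport fun y => F (g * y) :=
      F.hasCompactSupport.comp_homeomorph (Homeomorph.mulLeft g)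
    have h0 : ∫ x, F x ∂(map (g * ·) (RealRMK.rieszMeasure Λ)) =
        ∫ x, F (g * x) ∂(RealRMK.rieszMeasure Λ) :=
      (Homeomorph.mulLeft g).measurableEmbedding.integral_map _
    rw [h0]
    have h1 := hΛ ⟨⟨fun y => F (g * y), by fun_prop⟩, hF⟩
    have h2 : ∀ x, periodize Γ (fun y => F (g * y)) x = periodize Γ F (g • x) :=
      periodize_comp_mul_left Γ F g
    refine h1.trans ?_
    rw [hΛ, ← integral_smul_eq_self (μ := μ) (periodize Γ F) (g := g)]
    exact integral_congr_ae (ae_of_all _ h2)⟩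
  obtain ⟨c, hc⟩ := exists_integral_isMulLeftInvariant_eq_smul_of_hasCompactSupport
    (RealRMK.rieszMeasure Λ) (haar : Measure G)
  refine ⟨c, fun F hF hF' => ?_⟩
  have h1 := hΛ ⟨⟨F, hF⟩, hF'⟩
  refine h1.symm.trans ((hc F hF hF').trans ?_)
  rw [integral_smul_nnreal_measure]
  rfl

/-- Weil's formula: up to the constant `c`, integrating over `G` amounts to summing over `Γ` and
then integrating over `G ⧸ Γ`. -/
def IsWeilConstant (μ : Measure (G ⧸ Γ)) (c : ℝ) : Prop :=
  ∀ F : G → ℝ, Continuous F → HasCompactSupport F →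
    ∫ g, F g ∂(haar : Measure G) = c * ∫ x, periodize Γ F x ∂μ

theorem exists_isCompact_measure_compl_lt {X : Type*} [TopologicalSpace X] [MeasurableSpace X]
    [BorelSpace X] [T2Space X] (μ : Measure X) [IsFiniteMeasure μ] [μ.Regular] {ε : ENNReal}
    (hε : ε ≠ 0) : ∃ K, IsCompact K ∧ μ Kᶜ < ε := by
  obtain ⟨K, -, hK, h⟩ := MeasurableSet.univ.exists_isCompact_sdiff_lt (μ := μ) (by simp) hε
  exact ⟨K, hK, by rwa [compl_eq_univ_sdiff]⟩

theorem exists_isWeilConstant (μ : Measure (G ⧸ Γ)) [IsProbabilityMeasure μ] [μ.Regular]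
    [SMulInvariantMeasure G (G ⧸ Γ) μ] : ∃ c : ℝ, 0 < c ∧ IsWeilConstant Γ μ c := by
  obtain ⟨c, hc⟩ := exists_integral_periodize_eq_real Γ μ
  have hc0 : (c : ℝ) ≠ 0 := by
    intro h0
    obtain ⟨K, hK, hμK⟩ := exists_isCompact_measure_compl_lt μ one_ne_zero
    obtain ⟨⟨k, hkc⟩, hk1, -, hks, hk01⟩ :=
      exists_continuous_one_zero_of_isCompact hK isClosed_empty (disjoint_empty _)
    simp only [ContinuousMap.coe_mk] at hk1 hks hk01
    obtain ⟨h, hh, hhs, rfl⟩ := exists_periodize_eq Γ hkc hks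
    have h1 : ∫ x, periodize Γ h x ∂μ = 0 := by rw [hc h hh hhs, h0, zero_mul]
    rw [integral_eq_zero_iff_of_nonneg (fun x => (hk01 x).1) (integrable_periodize Γ μ hh hhs)] at h1
    have h2 : μ K = 0 := measure_mono_null (fun x hx => by simp [hk1 hx]) (ae_iff.1 h1)
    rw [prob_compl_eq_one_sub hK.measurableSet, h2] at hμK
    simp at hμK
  refine ⟨(c : ℝ)⁻¹, inv_pos.2 (c.2.lt_of_ne' hc0), fun F hF hF' => ?_⟩
  rw [hc F hF hF', inv_mul_cancel_left₀ hc0]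

variable {Γ}

theorem IsWeilConstant.integral_eq {μ : Measure (G ⧸ Γ)} [IsFiniteMeasureOnCompacts μ] {c : ℝ}
    (hc : IsWeilConstant Γ μ c) {E : Type*} [NormedAddCommGroup E] [NormedSpace ℝ E]
    [CompleteSpace E] {F : G → E} (hF : Continuous F) (hF' : HasCompactSupport F) :
    ∫ g, F g ∂(haar : Measure G) = c • ∫ x, periodize Γ F x ∂μ := by
  rw [SeparatingDual.eq_iff_forall_dual_eq (R := ℝ)]
  intro φ
  rw [map_smul, ← φ.integral_comp_comm (integrable_periodize Γ μ hF hF'),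
    ← φ.integral_comp_comm (hF.integrable_of_hasCompactSupport hF'), smul_eq_mul]
  refine (hc (fun g => φ (F g)) (by fun_prop) (hF'.comp_left (g := φ) (map_zero φ))).trans ?_
  congr 2 with x
  exact map_periodize Γ (φ : E →+ ℝ) hF' x

/-- Right translation by the lattice preserves Haar integrals. -/
theorem IsWeilConstant.integral_mul_right_eq {μ : Measure (G ⧸ Γ)} [IsFiniteMeasureOnCompacts μ]
    {c : ℝ} (hc : IsWeilConstant Γ μ c) {E : Type*} [NormedAddCommGroup E] [NormedSpace ℝ E]
    [CompleteSpace E] {F : G → E} (hF : Continuous F) (hF' : HasCompactSupport F) (γ : Γ) :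
    ∫ g, F (g * γ) ∂(haar : Measure G) = ∫ g, F g ∂(haar : Measure G) := by
  rw [hc.integral_eq (by fun_prop : Continuous fun g => F (g * γ))
    (hF'.comp_homeomorph (Homeomorph.mulRight (γ : G))), hc.integral_eq hF hF',
    periodize_comp_mul_right]

variable (Γ)

/-- The action of `G` on `G ⧸ Γ` is ergodic: the restriction of `μ` to an invariant set is an
invariant measure, hence proportional to `μ`. -/
theorem measure_eq_zero_or_of_smul_ae_eq (μ : Measure (G ⧸ Γ)) [IsProbabilityMeasure μ]
    [μ.Regular] [SMulInvariantMeasure G (G ⧸ Γ) μ] {A : Set (G ⧸ Γ)} (hA : MeasurableSet A)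
    (h : ∀ g : G, (g • ·) ⁻¹' A =ᵐ[μ] A) : μ A = 0 ∨ μ Aᶜ = 0 := by
  have : SMulInvariantMeasure G (G ⧸ Γ) (μ.restrict A) := ⟨fun g s hs => by
    have hm : MeasurableSet ((g • · : G ⧸ Γ → G ⧸ Γ) ⁻¹' s) := measurable_const_smul g hs
    rw [restrict_apply hm, restrict_apply hs, ← measure_preimage_smul μ g (s ∩ A),
      preimage_inter]
    exact measure_congr (Filter.EventuallyEq.rfl.inter (h g).symm)⟩
  have : (μ.restrict A).Regular := Regular.restrict_of_measure_ne_top (measure_ne_top μ A)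
  obtain ⟨c, hc0, hc⟩ := exists_isWeilConstant Γ μ
  obtain ⟨c', hc'⟩ := exists_integral_periodize_eq_real Γ (μ.restrict A)
  have key : ∀ k : G ⧸ Γ → ℝ, Continuous k → HasCompactSupport k →
      ∫ x, k x ∂(μ.restrict A) = c' * c * ∫ x, k x ∂μ := fun k hk hks => by
    obtain ⟨F, hF, hFs, rfl⟩ := exists_periodize_eq Γ hk hks
    rw [hc' F hF hFs, hc F hF hFs, mul_assoc]
  have heq : μ.restrict A = (c' * c.toNNReal) • μ := by
    refine Measure.ext_of_integral_eq_on_compactlySupported fun k => ?_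
    rw [integral_smul_nnreal_measure, key k k.continuous k.hasCompactSupport, NNReal.smul_def,
      NNReal.coe_mul, Real.coe_toNNReal c hc0.le, smul_eq_mul]
  have h0 : (μ.restrict A) Aᶜ = 0 := by rw [restrict_apply hA.compl]; simp
  rw [heq, Measure.smul_apply, smul_eq_zero] at h0
  refine h0.imp (fun h1 => ?_) id
  rw [← restrict_apply_self, heq, h1, zero_smul, Measure.coe_zero, Pi.zero_apply]

/-- A measurable function on `G ⧸ Γ` that is invariant up to null sets is almost everywhere
constant. -/
theorem exists_ae_eq_const_of_smul_ae_eq (μ : Measure (G ⧸ Γ)) [IsProbabilityMeasure μ]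
    [μ.Regular] [SMulInvariantMeasure G (G ⧸ Γ) μ] {f : G ⧸ Γ → ℂ} (hf : Measurable f)
    (h : ∀ g : G, (fun x => f (g • x)) =ᵐ[μ] f) : ∃ a : ℂ, f =ᵐ[μ] fun _ => a := by
  refine Filter.exists_eventuallyEq_const_of_forall_separating MeasurableSet fun U hU => ?_
  have hinv : ∀ g : G, (g • ·) ⁻¹' (f ⁻¹' U) =ᵐ[μ] f ⁻¹' U := fun g => by
    filter_upwards [h g] with x hx
    exact congrArg (· ∈ U) hx
  refine (measure_eq_zero_or_of_smul_ae_eq Γ μ (hf hU) hinv).symm.imp (fun h0 => ?_) fun h0 => ?_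
  · exact ae_iff.2 h0
  · exact measure_eq_zero_iff_ae_notMem.1 h0

/-- Continuous functions are almost everywhere limits of simple functions for a finite regular
measure, as the latter is carried by a σ-compact set. -/
theorem aestronglyMeasurable_of_continuous {X : Type*} [TopologicalSpace X] [MeasurableSpace X]
    [BorelSpace X] [T2Space X] (μ : Measure X) [IsFiniteMeasure μ] [μ.Regular] {E : Type*}
    [NormedAddCommGroup E] {Φ : X → E} (hΦ : Continuous Φ) : AEStronglyMeasurable Φ μ := by
  choose K hK hμK using fun n : ℕ => exists_isCompact_measure_compl_lt μ
    (ENNReal.inv_ne_zero.2 (ENNReal.natCast_ne_top n))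
  have h0 : μ (⋃ n, K n)ᶜ = 0 := by
    rw [compl_iUnion]
    by_contra hne
    obtain ⟨n, hn⟩ := ENNReal.exists_inv_nat_lt hne
    exact absurd (measure_mono (iInter_subset (fun n => (K n)ᶜ) n)) (hμK n |>.trans hn).not_ge
  have h1 : AEStronglyMeasurable Φ (μ.restrict (⋃ n, K n)) :=
    aestronglyMeasurable_iUnion_iff.2 fun n =>
      hΦ.continuousOn.aestronglyMeasurable_of_isCompact (hK n) (hK n).measurableSet
  rwa [restrict_eq_self_of_ae_mem (s := ⋃ n, K n) (ae_iff.2 h0)] at h1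

theorem integrable_of_continuous_of_enorm_le {X : Type*} [TopologicalSpace X] [MeasurableSpace X]
    [BorelSpace X] [T2Space X] (μ : Measure X) [IsFiniteMeasure μ] [μ.Regular] {E : Type*}
    [NormedAddCommGroup E] {Φ : X → E} (hΦ : Continuous Φ) {w : X → ENNReal}
    (hw : ∫⁻ x, w x ∂μ ≠ ⊤) {C : ℝ≥0} (h : ∀ᵐ x ∂μ, ‖Φ x‖ₑ ≤ w x * C) : Integrable Φ μ := by
  refine ⟨aestronglyMeasurable_of_continuous μ hΦ, (lintegral_mono_ae h).trans_lt ?_⟩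
  rw [lintegral_mul_const' _ _ ENNReal.coe_ne_top]
  exact ENNReal.mul_lt_top hw.lt_top ENNReal.coe_lt_top

/-- The mean over `G ⧸ Γ` of functions dominated by an integrable weight is uniformly approximated
by integrals over `G` against a compactly supported function. -/
theorem exists_norm_integral_smul_sub_le (μ : Measure (G ⧸ Γ)) [IsProbabilityMeasure μ]
    [μ.Regular] [SMulInvariantMeasure G (G ⧸ Γ) μ] {w : G ⧸ Γ → ENNReal}
    (hw : ∫⁻ x, w x ∂μ ≠ ⊤) {ε : ℝ} (hε : 0 < ε) :
    ∃ h : C_c(G, ℂ), ∀ {E : Type*} [NormedAddCommGroup E] [NormedSpace ℂ E] [CompleteSpace E]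
      {Φ : G ⧸ Γ → E} {C : ℝ≥0}, Continuous Φ → (∀ᵐ x ∂μ, ‖Φ x‖ₑ ≤ w x * C) →
      ‖∫ g, h g • Φ g ∂(haar : Measure G) - ∫ x, Φ x ∂μ‖ ≤ ε * C := by
  obtain ⟨c, hc0, hc⟩ := exists_isWeilConstant Γ μ
  obtain ⟨δ, hδ, hδw⟩ := exists_pos_setLIntegral_lt_of_measure_lt hw
    (ENNReal.ofReal_pos.2 hε).ne'
  obtain ⟨K, hK, hμK⟩ := exists_isCompact_measure_compl_lt μ hδ.ne'
  obtain ⟨⟨k, hkc⟩, hk1, -, hks, hk01⟩ :=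
    exists_continuous_one_zero_of_isCompact hK isClosed_empty (disjoint_empty _)
  simp only [ContinuousMap.coe_mk] at hk1 hks hk01
  obtain ⟨h, hh, hhs, hhk⟩ := exists_periodize_eq Γ (k := fun x => c⁻¹ * k x)
    (by fun_prop) hks.mul_left
  refine ⟨⟨⟨fun g => (h g : ℂ), by fun_prop⟩, hhs.comp_left (g := Complex.ofReal) rfl⟩, ?_⟩
  intro E _ _ _ Φ C hΦ hΦw
  have h1 : ∫ g, (h g : ℂ) • Φ g ∂(haar : Measure G) = ∫ x, k x • Φ x ∂μ := by
    simp_rw [Complex.coe_smul]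
    rw [hc.integral_eq (F := fun g => h g • Φ g)
      (hh.smul (hΦ.comp QuotientGroup.continuous_mk)) hhs.smul_right, ← integral_smul]
    congr 1 with x
    rw [periodize_smul, hhk, smul_smul, mul_inv_cancel_left₀ hc0.ne']
  have hint := integrable_of_continuous_of_enorm_le μ hΦ hw hΦw
  have hkint : Integrable (fun x => k x • Φ x) μ :=
    (hkc.smul hΦ).integrable_of_hasCompactSupport hks.smul_right
  have h2 : ‖∫ x, k x • Φ x ∂μ - ∫ x, Φ x ∂μ‖ₑ ≤ ENNReal.ofReal ε * C := by
    rw [← integral_sub hkint hint]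
    calc _ ≤ ∫⁻ x, ‖k x • Φ x - Φ x‖ₑ ∂μ := enorm_integral_le_lintegral_enorm _
      _ ≤ ∫⁻ x, Kᶜ.indicator w x * C ∂μ := lintegral_mono_ae <| by
          filter_upwards [hΦw] with x hx
          by_cases hxK : x ∈ K
          · simp [hk1 hxK]
          · rw [indicator_of_mem (by exact hxK)]
            refine le_trans ?_ hx
            have : k x • Φ x - Φ x = (k x - 1) • Φ x := by rw [sub_smul, one_smul]
            rw [this, enorm_smul]
            refine mul_le_of_le_one_left' ?_
            rw [← enorm_norm, Real.enorm_of_nonneg (norm_nonneg _), ENNReal.ofReal_le_one,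
              Real.norm_eq_abs, abs_le]
            constructor <;> linarith [(hk01 x).1, (hk01 x).2]
      _ ≤ ENNReal.ofReal ε * C := by
          rw [lintegral_mul_const' _ _ ENNReal.coe_ne_top, lintegral_indicator hK.measurableSet.compl]
          gcongr
          exact (hδw _ hμK).le
  change ‖∫ g, (h g : ℂ) • Φ g ∂(haar : Measure G) - _‖ ≤ _
  rw [h1]
  rw [← ofReal_norm, ← ENNReal.ofReal_coe_nnreal, ← ENNReal.ofReal_mul hε.le] at h2
  exact (ENNReal.ofReal_le_ofReal_iff (by positivity)).1 h2

end Quotient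

/-! ### Kazhdan projections as uniform limits -/

section Kazhdan

open Topology Filter

universe u

variable {G : Type u} [Group G] [TopologicalSpace G] [IsTopologicalGroup G]
  [LocallyCompactSpace G] [MeasurableSpace G] [BorelSpace G] {ℓ : LengthFunction G}

namespace CAlg

theorem norm_rep_le (π : HilbertRep ℓ) (a : CAlg ℓ) : ‖rep π a‖ ≤ ‖a‖ := by
  refine UniformSpace.Completion.induction_on a (isClosed_le (by fun_prop) (by fun_prop)) fun f => ?_
  rw [rep_coe, UniformSpace.Completion.norm_coe]
  exact ConvAlg.norm_rep_le π f

theorem rep_mul (π : HilbertRep ℓ) (a b : CAlg ℓ) : rep π (a * b) = rep π a * rep π b := by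
  refine UniformSpace.Completion.induction_on₂ a b (isClosed_eq (by fun_prop) (by fun_prop))
    fun f g => ?_
  rw [← coe_mul, rep_coe, rep_coe, rep_coe, ConvAlg.rep_mul]

/-- Elements of `C_ℓ(G)` are approximated by functions, uniformly over all representations. -/
theorem exists_norm_rep_sub_le (a : CAlg ℓ) {ε : ℝ} (hε : 0 < ε) :
    ∃ f : ConvAlg ℓ, ‖a - f‖ < ε ∧ ∀ π : HilbertRep ℓ, ‖ConvAlg.rep π f - rep π a‖ ≤ ε := by
  obtain ⟨f, hf⟩ := UniformSpace.Completion.denseRange_coe.exists_dist_lt a hε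
  rw [dist_eq_norm] at hf
  refine ⟨f, hf, fun π => ?_⟩
  rw [← rep_coe, norm_sub_rev, ← map_sub]
  exact (norm_rep_le π (a - f)).trans hf.le

theorem ext_rep {a b : CAlg ℓ} (h : ∀ π : HilbertRep ℓ, rep π a = rep π b) : a = b := by
  rw [← sub_eq_zero, ← norm_le_zero_iff]
  refine le_of_forall_pos_le_add fun ε hε => ?_
  obtain ⟨f, hf, hfπ⟩ := exists_norm_rep_sub_le (a - b) (half_pos hε)
  have h1 : ‖f‖ ≤ ε / 2 := ConvAlg.norm_le_of (half_pos hε).le fun π => by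
    simpa [map_sub, h π] using hfπ π
  calc ‖a - b‖ = ‖(a - b - f) + f‖ := by rw [sub_add_cancel]
    _ ≤ ‖a - b - f‖ + ‖(f : CAlg ℓ)‖ := norm_add_le _ _
    _ ≤ 0 + ε := by rw [UniformSpace.Completion.norm_coe]; linarith

end CAlg

theorem IsKazhdanProjection.rep_apply_eq {P : CAlg ℓ} (hP : IsKazhdanProjection P)
    {π : HilbertRep ℓ} {x : π.H} (hx : ∀ g, π.toHom g x = x) : CAlg.rep π P x = x := by
  obtain ⟨y, rfl⟩ : x ∈ Set.range (CAlg.rep π P) := by rw [hP.range_rep]; exact hx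
  exact congrArg (· y) (hP.isIdempotent_rep π)

theorem IsKazhdanProjection.toHom_rep_apply {P : CAlg ℓ} (hP : IsKazhdanProjection P)
    {π : HilbertRep ℓ} (x : π.H) (g : G) : π.toHom g (CAlg.rep π P x) = CAlg.rep π P x := by
  have : CAlg.rep π P x ∈ {x | ∀ g, π.toHom g x = x} := by rw [← hP.range_rep]; exact ⟨x, rfl⟩
  exact this g

/-- Projections `Q π` onto the invariant vectors that are uniform limits of operators `π(f)` come
from a Kazhdan projection. -/
theorem exists_isKazhdanProjection (Q : ∀ π : HilbertRep ℓ, π.H → π.H)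
    (happ : ∀ ε : ℝ, 0 < ε → ∃ f : ConvAlg ℓ, ∀ (π : HilbertRep ℓ) (x : π.H),
      ‖ConvAlg.rep π f x - Q π x‖ ≤ ε * ‖x‖)
    (hinv : ∀ (π : HilbertRep ℓ) (g : G) (x : π.H), π.toHom g (Q π x) = Q π x)
    (hfix : ∀ (π : HilbertRep ℓ) (x : π.H), (∀ g, π.toHom g x = x) → Q π x = x) :
    ∃ P : CAlg ℓ, IsKazhdanProjection P := by
  choose f hf using fun n : ℕ => happ (1 / ((n : ℝ) + 1)) (by positivity)
  have hdist : ∀ m n, dist (f m) (f n) ≤ 1 / ((m : ℝ) + 1) + 1 / ((n : ℝ) + 1) := fun m n => by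
    rw [dist_eq_norm]
    refine ConvAlg.norm_le_of (by positivity) fun π =>
      ContinuousLinearMap.opNorm_le_bound _ (by positivity) fun x => ?_
    rw [map_sub, add_mul]
    calc ‖ConvAlg.rep π (f m) x - ConvAlg.rep π (f n) x‖
        = ‖(ConvAlg.rep π (f m) x - Q π x) - (ConvAlg.rep π (f n) x - Q π x)‖ := by
          rw [sub_sub_sub_cancel_right]
      _ ≤ _ := (norm_sub_le _ _).trans (add_le_add (hf m π x) (hf n π x))
  have hlim := tendsto_one_div_add_atTop_nhds_zero_nat (𝕜 := ℝ)
  have hcau : CauchySeq fun n => (f n : CAlg ℓ) := by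
    refine cauchySeq_of_le_tendsto_0 (fun n : ℕ => 2 * (1 / ((n : ℝ) + 1))) (fun m n N hm hn => ?_)
      (by simpa using hlim.const_mul 2)
    rw [UniformSpace.Completion.dist_eq]
    have h1 := one_div_le_one_div_of_le (by positivity) (by gcongr : (N : ℝ) + 1 ≤ m + 1)
    have h2 := one_div_le_one_div_of_le (by positivity) (by gcongr : (N : ℝ) + 1 ≤ n + 1)
    linarith [hdist m n]
  obtain ⟨P, hP⟩ := cauchySeq_tendsto_of_complete hcau
  have hrep : ∀ (π : HilbertRep ℓ) (x : π.H), CAlg.rep π P x = Q π x := fun π x => by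
    have h1 : Tendsto (fun n => CAlg.rep π (f n : CAlg ℓ) x) atTop (𝓝 (CAlg.rep π P x)) :=
      ((by fun_prop : Continuous fun a => CAlg.rep π a x).tendsto P).comp hP
    refine tendsto_nhds_unique h1 (tendsto_iff_norm_sub_tendsto_zero.2 ?_)
    refine squeeze_zero (fun _ => norm_nonneg _) (fun n => ?_) (by simpa using hlim.mul_const ‖x‖)
    rw [CAlg.rep_coe]
    simpa using hf n π x
  have hidem : ∀ π : HilbertRep ℓ, CAlg.rep π P * CAlg.rep π P = CAlg.rep π P := fun π => by
    ext x
    rw [mul_apply_eq_comp, hrep, hrep, hfix π _ fun g => hinv π g x]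
  refine ⟨P, CAlg.ext_rep fun π => by rw [CAlg.rep_mul, hidem], hidem, fun π => ?_⟩
  ext x
  constructor
  · rintro ⟨y, rfl⟩ g
    rw [hrep, hinv]
  · intro hx
    exact ⟨x, by rw [hrep, hfix π x hx]⟩

end Kazhdan

/-! ### Averaging over a lattice -/

section Lattice

open Topology

universe u

variable {G : Type u} [Group G] [TopologicalSpace G] {Γ : Subgroup G}
  {ℓ : LengthFunction G} {ℓΓ : LengthFunction Γ}

/-- The restriction of a representation to a subgroup. -/
def HilbertRep.restrict (hℓ : ∀ γ : Γ, ℓ γ ≤ ℓΓ γ) (π : HilbertRep ℓ) : HilbertRep ℓΓ where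
  H := π.H
  toHom := π.toHom.comp Γ.subtype
  continuous_apply x := (π.continuous_apply x).comp continuous_subtype_val
  norm_le γ := (π.norm_le γ).trans (Real.exp_le_exp.2 (hℓ γ))

/-- The function `gΓ ↦ π(g) ξ` on `G ⧸ Γ`, for a `Γ`-invariant vector `ξ`. For other vectors the
value depends on the choice of a representative of the coset. -/
def HilbertRep.orbitMap (π : HilbertRep ℓ) (ξ : π.H) (x : G ⧸ Γ) : π.H := π.toHom x.out ξ

theorem HilbertRep.orbitMap_mk (π : HilbertRep ℓ) {ξ : π.H} (hξ : ∀ γ : Γ, π.toHom γ ξ = ξ)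
    (g : G) : π.orbitMap ξ (g : G ⧸ Γ) = π.toHom g ξ := by
  obtain ⟨γ, h⟩ := QuotientGroup.mk_out_eq_mul Γ g
  rw [orbitMap, h, map_mul, mul_apply_eq_comp, hξ]

theorem HilbertRep.continuous_orbitMap (π : HilbertRep ℓ) {ξ : π.H}
    (hξ : ∀ γ : Γ, π.toHom γ ξ = ξ) : Continuous (π.orbitMap ξ : G ⧸ Γ → π.H) := by
  rw [(QuotientGroup.isQuotientMap_mk Γ).continuous_iff]
  exact (π.continuous_apply ξ).congr fun g => (π.orbitMap_mk hξ g).symm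

theorem HilbertRep.orbitMap_smul (π : HilbertRep ℓ) {ξ : π.H}
    (hξ : ∀ γ : Γ, π.toHom γ ξ = ξ) (g : G) (x : G ⧸ Γ) :
    π.orbitMap ξ (g • x) = π.toHom g (π.orbitMap ξ x) := by
  induction x using QuotientGroup.induction_on with
  | H x =>
    rw [π.orbitMap_mk hξ, ← mul_apply_eq_comp, ← map_mul, ← π.orbitMap_mk hξ]
    rfl

/-- On a discrete group the integrated form of a representation is a finite sum. -/
theorem HilbertRep.opOf_eq_sum {Λ : Type u} [Group Λ] [TopologicalSpace Λ] [IsTopologicalGroup Λ]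
    [LocallyCompactSpace Λ] [MeasurableSpace Λ] [BorelSpace Λ] [DiscreteTopology Λ]
    (f : C_c(Λ, ℂ)) : ∃ (s : Finset Λ) (a : Λ → ℂ), ∀ {ℓ : LengthFunction Λ} (ρ : HilbertRep ℓ)
      (x : ρ.H), ρ.opOf f x = ∑ γ ∈ s, a γ • ρ.toHom γ x := by
  let s := f.hasCompactSupport.isCompact.finite_of_discrete.toFinset
  refine ⟨s, fun γ => (haar : Measure Λ).real {γ} • f γ, fun ρ x => ?_⟩
  have h1 : ∫ γ in (s : Set Λ), f γ • ρ.toHom γ x ∂(haar : Measure Λ) =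
      ∫ γ, f γ • ρ.toHom γ x ∂(haar : Measure Λ) :=
    setIntegral_eq_integral_of_forall_compl_eq_zero fun γ hγ => by
      have : γ ∉ tsupport f := by simpa [s] using hγ
      rw [image_eq_zero_of_notMem_tsupport this, zero_smul]
  rw [ρ.opOf_apply, ← h1, setIntegral_finset
    (hf := (integrable_smul f (ρ.continuous_apply x)).integrableOn)]
  simp_rw [smul_assoc]

variable [IsTopologicalGroup G] [LocallyCompactSpace G] [T2Space G] [MeasurableSpace G]
  [BorelSpace G] [DiscreteTopology Γ] [MeasurableSpace (G ⧸ Γ)] [BorelSpace (G ⧸ Γ)]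

/-- A function on `G` can be convolved from the right with a finitely supported function on `Γ`. -/
theorem IsWeilConstant.exists_opOf_eq_mul {μ : Measure (G ⧸ Γ)} [IsFiniteMeasureOnCompacts μ]
    {c : ℝ} (hc : IsWeilConstant Γ μ c) (h : C_c(G, ℂ)) (f : C_c(Γ, ℂ)) : ∃ h' : C_c(G, ℂ),
    ∀ {ℓ : LengthFunction G} {ℓΓ : LengthFunction Γ} (hℓ : ∀ γ : Γ, ℓ γ ≤ ℓΓ γ)
      (π : HilbertRep ℓ) (x : π.H), π.opOf h' x = π.opOf h ((π.restrict hℓ).opOf f x) := by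
  obtain ⟨s, a, hs⟩ := HilbertRep.opOf_eq_sum f
  let t : Γ → C_c(G, ℂ) := fun γ => ⟨⟨fun g => h (g * (γ : G)⁻¹), by fun_prop⟩,
    h.hasCompactSupport.comp_homeomorph (Homeomorph.mulRight (γ : G)⁻¹)⟩
  have ht : ∀ {ℓ : LengthFunction G} (π : HilbertRep ℓ) (γ : Γ) (x : π.H),
      π.opOf (t γ) x = π.opOf h (π.toHom γ x) := fun π γ x => by
    rw [π.opOf_apply, π.opOf_apply]
    have := hc.integral_mul_right_eq (F := fun g => t γ g • π.toHom g x)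
      ((t γ).continuous.smul (π.continuous_apply x)) (t γ).hasCompactSupport.smul_right γ
    rw [← this]
    congr 1 with g
    change h (g * γ * (γ : G)⁻¹) • _ = _
    rw [mul_inv_cancel_right, map_mul, mul_apply_eq_comp]
  refine ⟨∑ γ ∈ s, a γ • t γ, fun {ℓ ℓΓ} hℓ π x => ?_⟩
  have h1 : π.opOf (∑ γ ∈ s, a γ • t γ) = ∑ γ ∈ s, a γ • π.opOf (t γ) := by
    have := map_sum (ConvAlg.rep π) (fun γ => a γ • ConvAlg.of ℓ (t γ)) s
    simp_rw [map_smul] at this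
    exact this
  have h2 : (π.restrict hℓ).opOf f x = ∑ γ ∈ s, a γ • π.toHom (γ : G) x :=
    hs (π.restrict hℓ) x
  rw [h1, h2]
  simp only [_root_.sum_apply, _root_.smul_apply, ht, _root_.map_sum, map_smul]

/-- If `Γ` has a Kazhdan projection `P` and the growth of the representations of `G` is integrable
over `G ⧸ Γ`, then `∫ π(g) π(P) dμ(gΓ)` projects onto the `G`-invariant vectors, and defines a
Kazhdan projection for `G`. -/
theorem exists_isKazhdanProjection_of_lattice (μ : Measure (G ⧸ Γ)) [IsProbabilityMeasure μ]
    [μ.Regular] [SMulInvariantMeasure G (G ⧸ Γ) μ] (hℓ : ∀ γ : Γ, ℓ γ ≤ ℓΓ γ) {P : CAlg ℓΓ}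
    (hP : IsKazhdanProjection P) {w : G ⧸ Γ → ENNReal} (hw : ∫⁻ x, w x ∂μ ≠ ⊤)
    (hℓw : ∀ᵐ x ∂μ, ∃ g : G, (g : G ⧸ Γ) = x ∧ ENNReal.ofReal (Real.exp (ℓ g)) ≤ w x) :
    ∃ P' : CAlg ℓ, IsKazhdanProjection P' := by
  let p : ∀ π : HilbertRep ℓ, π.H →L[ℂ] π.H := fun π => CAlg.rep (π.restrict hℓ) P
  have hp : ∀ (π : HilbertRep ℓ) (x : π.H) (γ : Γ), π.toHom γ (p π x) = p π x :=
    fun π x γ => hP.toHom_rep_apply (π := π.restrict hℓ) x γ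
  have hbound : ∀ (π : HilbertRep ℓ) (x : π.H),
      ∀ᵐ y ∂μ, ‖π.orbitMap (p π x) y‖ₑ ≤ w y * ‖p π x‖₊ := fun π x => by
    filter_upwards [hℓw] with y hy
    obtain ⟨g, rfl, hg⟩ := hy
    rw [π.orbitMap_mk (hp π x)]
    refine le_trans ?_ (mul_le_mul_left hg _)
    rw [← ofReal_norm, ← enorm_eq_nnnorm, ← ofReal_norm, ← ENNReal.ofReal_mul (Real.exp_pos _).le]
    exact ENNReal.ofReal_le_ofReal ((π.toHom g).le_of_opNorm_le (π.norm_le g) _)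
  refine exists_isKazhdanProjection (fun π x => ∫ y, π.orbitMap (p π x) y ∂μ) (fun ε hε => ?_)
    (fun π g x => ?_) fun π x hx => ?_
  · obtain ⟨c, -, hc⟩ := exists_isWeilConstant Γ μ
    obtain ⟨h, hh⟩ := exists_norm_integral_smul_sub_le.{u, u} Γ μ hw
      (ε := ε / 2 / (‖P‖ + 1)) (by positivity)
    obtain ⟨f, -, hf⟩ := CAlg.exists_norm_rep_sub_le P
      (ε := ε / 2 / (‖ConvAlg.of ℓ h‖ + 1)) (by positivity)
    obtain ⟨h', hh'⟩ := hc.exists_opOf_eq_mul h ((ConvAlg.of ℓΓ).symm f)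
    refine ⟨ConvAlg.of ℓ h', fun π x => ?_⟩
    have h1 : ‖π.opOf h (p π x) - ∫ y, π.orbitMap (p π x) y ∂μ‖ ≤ ε / 2 * ‖x‖ := by
      have := hh (π.continuous_orbitMap (hp π x)) (hbound π x)
      simp_rw [π.orbitMap_mk (hp π x)] at this
      refine this.trans ?_
      have h3 : ‖p π x‖ ≤ ‖P‖ * ‖x‖ := (p π).le_of_opNorm_le (CAlg.norm_rep_le _ P) x
      calc ε / 2 / (‖P‖ + 1) * ‖p π x‖ ≤ ε / 2 / (‖P‖ + 1) * ((‖P‖ + 1) * ‖x‖) := by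
            gcongr
            exact h3.trans (by gcongr; linarith)
        _ = ε / 2 * ‖x‖ := by field_simp
    let A : π.H →L[ℂ] π.H := ConvAlg.rep (π.restrict hℓ) f
    have h2 : ‖π.opOf h (A x - p π x)‖
        ≤ ε / 2 * ‖x‖ := by
      set b := ‖ConvAlg.of ℓ h‖ with hb
      have hb0 : 0 ≤ b := norm_nonneg _
      have h3 : ‖A x - p π x‖ ≤
          ε / 2 / (b + 1) * ‖x‖ :=
        (A - p π).le_of_opNorm_le (hf (π.restrict hℓ)) x
      calc _ ≤ b * (ε / 2 / (b + 1) * ‖x‖) :=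
            ((π.opOf h).le_of_opNorm_le (ConvAlg.norm_rep_le π (ConvAlg.of ℓ h)) _).trans
              (mul_le_mul_of_nonneg_left h3 hb0)
        _ ≤ (b + 1) * (ε / 2 / (b + 1) * ‖x‖) := by gcongr; linarith
        _ = ε / 2 * ‖x‖ := by field_simp
    have h4 : ConvAlg.rep π (ConvAlg.of ℓ h') x = π.opOf h (A x) := hh' hℓ π x
    rw [h4]
    calc _ = ‖π.opOf h (A x - p π x) +
          (π.opOf h (p π x) - ∫ y, π.orbitMap (p π x) y ∂μ)‖ := by
            congr 1
            rw [map_sub]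
            abel
      _ ≤ ε / 2 * ‖x‖ + ε / 2 * ‖x‖ := (norm_add_le _ _).trans (add_le_add h2 h1)
      _ = ε * ‖x‖ := by ring
  · have hint := integrable_of_continuous_of_enorm_le μ (π.continuous_orbitMap (hp π x)) hw
      (hbound π x)
    rw [← (π.toHom g).integral_comp_comm hint, ← integral_smul_eq_self (μ := μ) (π.orbitMap (p π x)) (g := g)]
    simp_rw [π.orbitMap_smul (hp π x)]
  · have h1 : p π x = x := hP.rep_apply_eq (π := π.restrict hℓ) fun γ => hx γ
    simp_rw [h1, HilbertRep.orbitMap, hx]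
    simp

end Lattice

/-! ### The representation on `L²(G ⧸ Γ)` and the decay of the cusps -/

section Decay

open Topology Pointwise

universe u

variable {G : Type u} [Group G] [TopologicalSpace G] [IsTopologicalGroup G]
  [LocallyCompactSpace G] [T2Space G] [MeasurableSpace G] [BorelSpace G] {Γ : Subgroup G}
  [DiscreteTopology Γ] [MeasurableSpace (G ⧸ Γ)] [BorelSpace (G ⧸ Γ)]
  (μ : Measure (G ⧸ Γ)) [IsProbabilityMeasure μ] [μ.Regular] [SMulInvariantMeasure G (G ⧸ Γ) μ]
  (ℓ : LengthFunction G)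

/-- The unitary action of `G` on `L²(G ⧸ Γ)` by `(g v)(x) = v(g⁻¹ x)`. -/
def translation : G →* (Lp ℂ 2 μ →L[ℂ] Lp ℂ 2 μ) where
  toFun g := LinearMap.mkContinuous
    { toFun := fun v => DomMulAct.mk g⁻¹ • v
      map_add' := smul_add _
      map_smul' := fun _ _ => smul_comm _ _ _ } 1
    fun v => by rw [one_mul]; exact (DomMulAct.norm_smul_Lp _ v).le
  map_one' := by ext1 v; simp
  map_mul' g h := by
    ext1 v
    change DomMulAct.mk (g * h)⁻¹ • v = DomMulAct.mk g⁻¹ • DomMulAct.mk h⁻¹ • v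
    rw [mul_inv_rev, DomMulAct.mk_mul, mul_smul]

theorem translation_apply (g : G) (v : Lp ℂ 2 μ) :
    translation μ g v = DomMulAct.mk g⁻¹ • v := rfl

theorem norm_translation_apply (g : G) (v : Lp ℂ 2 μ) : ‖translation μ g v‖ = ‖v‖ :=
  DomMulAct.norm_smul_Lp _ v

/-- The representation of `G` on `L²(G ⧸ Γ)`. As it is unitary, it is bounded by `exp ℓ` for every
length function `ℓ`. -/
abbrev quasiRegular : HilbertRep ℓ where
  H := Lp ℂ 2 μ
  toHom := translation μ
  continuous_apply v := by
    have : Fact ((2 : ENNReal) ≠ ⊤) := ⟨by simp⟩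
    exact (DomMulAct.continuous_mk.comp continuous_inv).smul continuous_const
  norm_le g := (ContinuousLinearMap.opNorm_le_bound _ zero_le_one fun v => by
    rw [one_mul, norm_translation_apply]).trans (Real.one_le_exp (ℓ.nonneg g))

/-- The indicator function of `C`, as an element of `L²`. -/
def ind {C : Set (G ⧸ Γ)} (hC : MeasurableSet C) : Lp ℂ 2 μ :=
  indicatorConstLp 2 hC (measure_ne_top μ C) 1

theorem norm_ind {C : Set (G ⧸ Γ)} (hC : MeasurableSet C) : ‖ind μ hC‖ = √(μ.real C) := by
  rw [ind, norm_indicatorConstLp (by simp) (by simp), norm_one, one_mul, Real.sqrt_eq_rpow]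
  simp

theorem norm_ind_le {C : Set (G ⧸ Γ)} (hC : MeasurableSet C) : ‖ind μ hC‖ ≤ 1 := by
  rw [norm_ind, Real.sqrt_le_one]
  exact measureReal_le_one

theorem inner_ind_ind {C D : Set (G ⧸ Γ)} (hC : MeasurableSet C) (hD : MeasurableSet D) :
    inner ℂ (ind μ hC) (ind μ hD) = μ.real (C ∩ D) := by
  rw [ind, L2.inner_indicatorConstLp_one, ind]
  rw [setIntegral_indicatorConstLp hC]
  simp [Set.inter_comm]

variable {ℓ}

theorem translation_ind {C : Set (G ⧸ Γ)} (hC : MeasurableSet C) (g : G) :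
    translation μ g (ind μ hC) = ind μ (measurable_const_smul g⁻¹ hC) := by
  rw [translation_apply, ind, DomMulAct.mk_smul_indicatorConstLp]
  rfl

theorem inner_ind_translation {C : Set (G ⧸ Γ)} (hC : MeasurableSet C) (g : G) (v : Lp ℂ 2 μ) :
    inner ℂ (ind μ hC) (translation μ g v) =
      inner ℂ (ind μ (measurable_const_smul g hC)) v := by
  let U : Lp ℂ 2 μ →ₗᵢ[ℂ] Lp ℂ 2 μ :=
    ⟨(translation μ g : Lp ℂ 2 μ →L[ℂ] Lp ℂ 2 μ), norm_translation_apply μ g⟩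
  have h1 : translation μ g (ind μ (measurable_const_smul g hC)) = ind μ hC := by
    rw [translation_ind]
    have : (g⁻¹ • · : G ⧸ Γ → G ⧸ Γ) ⁻¹' ((g • · : G ⧸ Γ → G ⧸ Γ) ⁻¹' C) = C := by
      ext x; simp
    simp only [this]
  refine Eq.trans ?_ (U.inner_map_map _ v)
  exact congrArg (fun u => inner ℂ u (translation μ g v)) h1.symm

theorem inner_opOf_quasiRegular (f : C_c(G, ℂ)) (u v : Lp ℂ 2 μ) :
    inner ℂ u ((quasiRegular μ ℓ).opOf f v) =
      ∫ g, f g * inner ℂ u (translation μ g v) ∂(haar : Measure G) := by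
  have := ((innerSL ℂ u).integral_comp_comm
    (integrable_smul f ((quasiRegular μ ℓ).continuous_apply v)))
  rw [HilbertRep.opOf_apply]
  refine this.symm.trans ?_
  congr 1 with g
  rw [map_smul]
  rfl

/-- If `v` vanishes off `A`, then `f * v` vanishes off `(supp f) A`. -/
theorem inner_ind_opOf_eq_zero (f : C_c(G, ℂ)) {A : Set (G ⧸ Γ)} {v : Lp ℂ 2 μ}
    (hv : ∀ (C : Set (G ⧸ Γ)) (hC : MeasurableSet C), Disjoint C A → inner ℂ (ind μ hC) v = 0)
    (C : Set (G ⧸ Γ)) (hC : MeasurableSet C) (hCA : Disjoint C (tsupport f • A)) :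
    inner ℂ (ind μ hC) ((quasiRegular μ ℓ).opOf f v) = 0 := by
  rw [inner_opOf_quasiRegular]
  refine integral_eq_zero_of_ae (ae_of_all _ fun g => ?_)
  by_cases hg : g ∈ tsupport f
  · simp only [inner_ind_translation, Pi.zero_apply]
    rw [hv, mul_zero]
    refine Set.disjoint_left.2 fun x hx hxA => ?_
    exact Set.disjoint_left.1 hCA hx (Set.smul_mem_smul hg hxA)
  · simp [image_eq_zero_of_notMem_tsupport hg]

/-- The constant function `1`, as an element of `L²(G ⧸ Γ)`. -/
def oneLp : Lp ℂ 2 μ := ind μ MeasurableSet.univ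

theorem norm_oneLp : ‖oneLp μ‖ = 1 := by simp [oneLp, norm_ind]

theorem translation_oneLp (g : G) : translation μ g (oneLp μ) = oneLp μ :=
  translation_ind μ _ g

theorem opOf_quasiRegular_oneLp (f : C_c(G, ℂ)) :
    (quasiRegular μ ℓ).opOf f (oneLp μ) = (∫ g, f g ∂(haar : Measure G)) • oneLp μ := by
  rw [HilbertRep.opOf_apply]
  simp_rw [translation_oneLp]
  exact integral_smul_const _ _

theorem inner_oneLp_translation (g : G) (v : Lp ℂ 2 μ) :
    inner ℂ (oneLp μ) (translation μ g v) = inner ℂ (oneLp μ) v :=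
  inner_ind_translation μ _ g v

theorem inner_oneLp_opOf_eq_zero (f : C_c(G, ℂ)) {v : Lp ℂ 2 μ} (hv : inner ℂ (oneLp μ) v = 0) :
    inner ℂ (oneLp μ) ((quasiRegular μ ℓ).opOf f v) = 0 := by
  rw [inner_opOf_quasiRegular]
  simp_rw [inner_oneLp_translation, hv, mul_zero, integral_zero]

/-- By ergodicity, the invariant vectors of `L²(G ⧸ Γ)` are the constants. -/
theorem exists_eq_smul_oneLp {v : Lp ℂ 2 μ} (hv : ∀ g, translation μ g v = v) :
    ∃ a : ℂ, v = a • oneLp μ := by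
  obtain ⟨a, ha⟩ := exists_ae_eq_const_of_smul_ae_eq Γ μ (Lp.stronglyMeasurable v).measurable
    fun g => by
      have h1 := DomMulAct.smul_Lp_ae_eq (DomMulAct.mk g) v
      have h2 : DomMulAct.mk g • v = v := by simpa [translation_apply] using hv g⁻¹
      rw [h2] at h1
      exact h1.symm
  refine ⟨a, Lp.ext ?_⟩
  filter_upwards [ha, Lp.coeFn_smul a (oneLp μ),
    indicatorConstLp_coeFn (p := 2) (hs := MeasurableSet.univ) (hμs := measure_ne_top μ _)
      (c := (1 : ℂ))] with x h1 h2 h3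
  rw [h1, h2, Pi.smul_apply, oneLp, ind, h3]
  simp

/-- A Kazhdan projection annihilates the functions of mean zero. -/
theorem IsKazhdanProjection.rep_quasiRegular_eq_zero {P : CAlg ℓ} (hP : IsKazhdanProjection P)
    {v : Lp ℂ 2 μ} (hv : inner ℂ (oneLp μ) v = 0) : CAlg.rep (quasiRegular μ ℓ) P v = 0 := by
  have h0 : ∀ a : CAlg ℓ, inner ℂ (oneLp μ) (CAlg.rep (quasiRegular μ ℓ) a v : Lp ℂ 2 μ) = 0 :=
    fun a => UniformSpace.Completion.induction_on a
      (isClosed_eq (continuous_const.inner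
        (by fun_prop : Continuous fun a => CAlg.rep (quasiRegular μ ℓ) a v)) continuous_const)
      fun f => by
        rw [CAlg.rep_coe]
        exact inner_oneLp_opOf_eq_zero μ _ hv
  obtain ⟨a, ha⟩ := exists_eq_smul_oneLp μ 
    (hP.toHom_rep_apply (π := quasiRegular μ ℓ) v)
  have h1 := h0 P
  rw [ha, inner_smul_right, inner_self_eq_norm_sq_to_K, norm_oneLp] at h1
  have : a = 0 := by simpa using h1
  rw [ha, this, zero_smul]

theorem isCompact_pow {M : Type*} [Monoid M] [TopologicalSpace M] [ContinuousMul M] {S : Set M}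
    (hS : IsCompact S) (m : ℕ) : IsCompact (S ^ m) := by
  induction m with
  | zero => simp
  | succ m ih => rw [pow_succ]; exact ih.mul hS

/-- If `G` has a Kazhdan projection, then `G ⧸ Γ` is exhausted exponentially fast by the images of
the powers of a compact set. The reason is that `f * ⋯ * f * 1_A` converges exponentially fast to a
nonzero constant in `L²(G ⧸ Γ)` when `f` is close to the Kazhdan projection. -/
theorem IsKazhdanProjection.exists_measure_compl_le {P : CAlg ℓ} (hP : IsKazhdanProjection P) :
    ∃ (S : Set G) (A : Set (G ⧸ Γ)) (D : ℝ), IsCompact S ∧ IsCompact A ∧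
      ∀ m : ℕ, μ.real (S ^ m • A)ᶜ ≤ D * (1 / 3) ^ m := by
  obtain ⟨A, hA, hμA⟩ := exists_isCompact_measure_compl_lt μ one_ne_zero
  obtain ⟨f, -, hf⟩ := CAlg.exists_norm_rep_sub_le P (ε := 1 / 4) (by norm_num)
  let F : C_c(G, ℂ) := (ConvAlg.of ℓ).symm f
  let T : Lp ℂ 2 μ →L[ℂ] Lp ℂ 2 μ := (quasiRegular μ ℓ).opOf F
  let E : Lp ℂ 2 μ →L[ℂ] Lp ℂ 2 μ := CAlg.rep (quasiRegular μ ℓ) P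
  have hTE : ‖T - E‖ ≤ 1 / 4 := hf (quasiRegular μ ℓ)
  set a : ℂ := ∫ g, F g ∂(haar : Measure G)
  have hT1 : T (oneLp μ) = a • oneLp μ := opOf_quasiRegular_oneLp μ F
  have hE1 : E (oneLp μ) = oneLp μ :=
    hP.rep_apply_eq (π := quasiRegular μ ℓ) (translation_oneLp μ)
  have ha : 3 / 4 ≤ ‖a‖ := by
    have h1 := (T - E).le_of_opNorm_le hTE (oneLp μ)
    rw [_root_.sub_apply, hT1, hE1, norm_oneLp, mul_one, ← one_smul ℂ (oneLp μ), smul_smul, mul_one,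
      ← sub_smul, norm_smul, norm_oneLp, mul_one] at h1
    have h2 := norm_sub_norm_le (1 : ℂ) a
    rw [norm_one, norm_sub_rev] at h2
    linarith
  have hα : 0 < μ.real A := by
    rw [measureReal_def, ENNReal.toReal_pos_iff]
    refine ⟨pos_iff_ne_zero.2 fun h0 => ?_, measure_lt_top _ _⟩
    rw [prob_compl_eq_one_sub hA.measurableSet, h0] at hμA
    simp at hμA
  set α := μ.real A with hαdef
  let v : Lp ℂ 2 μ := ind μ hA.measurableSet - (α : ℂ) • oneLp μ
  have hv : inner ℂ (oneLp μ) v = 0 := by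
    rw [inner_sub_right, inner_smul_right, oneLp, inner_ind_ind, inner_ind_ind]
    simp [hαdef]
  have hTv : ∀ m : ℕ, inner ℂ (oneLp μ) ((T ^ m) v) = 0 ∧ ‖(T ^ m) v‖ ≤ (1 / 4) ^ m * ‖v‖ := by
    intro m
    induction m with
    | zero => simp [hv]
    | succ m ih =>
      have h1 : (T ^ (m + 1)) v = T ((T ^ m) v) := by rw [pow_succ', mul_apply_eq_comp]
      have h2 : E ((T ^ m) v) = 0 := hP.rep_quasiRegular_eq_zero μ ih.1
      rw [h1]
      refine ⟨inner_oneLp_opOf_eq_zero μ F ih.1, ?_⟩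
      have h3 := (T - E).le_of_opNorm_le hTE ((T ^ m) v)
      rw [_root_.sub_apply, h2, sub_zero] at h3
      rw [pow_succ']
      linarith [ih.2]
  have hT1m : ∀ m : ℕ, (T ^ m) (oneLp μ) = a ^ m • oneLp μ := by
    intro m
    induction m with
    | zero => simp
    | succ m ih => rw [pow_succ, mul_apply_eq_comp, hT1, map_smul, ih, smul_smul, pow_succ']
  have hsupp : ∀ (m : ℕ) (C : Set (G ⧸ Γ)) (hC : MeasurableSet C), Disjoint C (tsupport F ^ m • A) →
      inner ℂ (ind μ hC) ((T ^ m) (ind μ hA.measurableSet)) = 0 := by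
    intro m
    induction m with
    | zero =>
      intro C hC hCA
      rw [pow_zero, one_smul] at hCA
      rw [pow_zero, one_apply_eq_self, inner_ind_ind, hCA.inter_eq]
      simp
    | succ m ih =>
      rw [pow_succ', pow_succ', mul_smul, mul_apply_eq_comp]
      exact inner_ind_opOf_eq_zero μ F ih
  refine ⟨tsupport F, A, ‖v‖ / α, F.hasCompactSupport, hA, fun m => ?_⟩
  have hC : MeasurableSet (tsupport F ^ m • A)ᶜ :=
    ((isCompact_pow F.hasCompactSupport.isCompact m).smul_set hA).measurableSet.compl
  have h0 := hsupp m _ hC disjoint_compl_left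
  have h1 : ind μ hA.measurableSet = (α : ℂ) • oneLp μ + v := by simp [v]
  rw [h1, map_add, map_smul, hT1m, inner_add_right, inner_smul_right, inner_smul_right, oneLp,
    inner_ind_ind, Set.inter_univ] at h0
  set t := μ.real (tsupport F ^ m • A)ᶜ
  have h2 : ‖inner ℂ (ind μ hC) ((T ^ m) v)‖ ≤ (1 / 4) ^ m * ‖v‖ :=
    (norm_inner_le_norm _ _).trans
      ((mul_le_of_le_one_left (norm_nonneg _) (norm_ind_le μ hC)).trans (hTv m).2)
  have ht : 0 ≤ t := measureReal_nonneg
  have h3 : α * (‖a‖ ^ m * t) ≤ (1 / 4) ^ m * ‖v‖ := by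
    rw [eq_neg_of_add_eq_zero_right h0, norm_neg, norm_mul, norm_mul, norm_pow, Complex.norm_real,
      Complex.norm_real, Real.norm_of_nonneg hα.le, Real.norm_of_nonneg ht] at h2
    exact h2
  have h4 : (3 / 4 : ℝ) ^ m * (α * t) ≤ (3 / 4) ^ m * ((1 / 3) ^ m * ‖v‖) := by
    rw [← mul_assoc ((3 / 4 : ℝ) ^ m) ((1 / 3) ^ m), ← mul_pow]
    norm_num only at h3 ⊢
    refine le_trans ?_ h3
    rw [mul_left_comm]
    gcongr
  have h5 := le_of_mul_le_mul_left h4 (by positivity)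
  rw [div_mul_eq_mul_div, le_div_iff₀ hα]
  linarith

end Decay

/-! ### Integrability of length functions over the quotient -/

section Weight

open Topology Pointwise

universe u

variable {G : Type u} [Group G] [TopologicalSpace G]

theorem LengthFunction.le_of_mem_pow (ℓ : LengthFunction G) {S : Set G} {M : ℝ}
    (hS : ∀ g ∈ S, ℓ g ≤ M) (m : ℕ) : ∀ g ∈ S ^ m, ℓ g ≤ m * M + ℓ 1 := by
  induction m with
  | zero => simp
  | succ m ih =>
    rw [pow_succ']
    rintro _ ⟨g, hg, h, hh, rfl⟩
    have h1 := ℓ.mul_le g h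
    have h2 := hS g hg
    have h3 := ih h hh
    push_cast
    linarith

/-- A Kazhdan projection makes `exp (s ℓ + c)` integrable over `G ⧸ Γ` for small `s`, with the
bound on `s` independent of `c`: outside the image of the `m`-th power of a compact set, whose
complement has exponentially small measure, the length grows at most linearly in `m`. Since `ℓ` need
not be measurable, it is replaced by a measurable upper bound. -/
theorem IsKazhdanProjection.exists_weight [IsTopologicalGroup G] [LocallyCompactSpace G]
    [T2Space G] [MeasurableSpace G] [BorelSpace G] {Γ : Subgroup G} [DiscreteTopology Γ]
    [MeasurableSpace (G ⧸ Γ)] [BorelSpace (G ⧸ Γ)] (μ : Measure (G ⧸ Γ)) [IsProbabilityMeasure μ]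
    [μ.Regular] [SMulInvariantMeasure G (G ⧸ Γ) μ] {ℓ₀ : LengthFunction G} {P : CAlg ℓ₀}
    (hP : IsKazhdanProjection P) (ℓ : LengthFunction G) {t : ℝ≥0} (ht : 0 < t) :
    ∃ s : ℝ≥0, 0 < s ∧ s ≤ t ∧ ∀ c : ℝ≥0, ∃ w : G ⧸ Γ → ENNReal, ∫⁻ x, w x ∂μ ≠ ⊤ ∧
      ∀ x, ∃ g : G, (g : G ⧸ Γ) = x ∧ ENNReal.ofReal (Real.exp (ℓ.scaleAdd s c g)) ≤ w x := by
  obtain ⟨S, A, D, hS, hA, hD⟩ := hP.exists_measure_compl_le μ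
  obtain ⟨L, hL, hAL⟩ := exists_isCompact_image_mk Γ hA
  obtain ⟨M, hM0, hM⟩ : ∃ M : ℝ, 0 ≤ M ∧ ∀ g ∈ S, ℓ g ≤ M := by
    obtain ⟨M, hM⟩ := ℓ.bddAbove_image S hS
    exact ⟨max 0 M, le_max_left _ _, fun g hg => (hM ⟨g, hg, rfl⟩).trans (le_max_right _ _)⟩
  obtain ⟨N, hN⟩ := ℓ.bddAbove_image L hL
  have hlog : 0 < Real.log 2 / (M + 1) := div_pos (Real.log_pos one_lt_two) (by linarith)
  -- With this choice the growth factor `exp (s M)` is at most `2`, and is beaten by the decay rate.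
  let s : ℝ≥0 := min t (Real.log 2 / (M + 1)).toNNReal
  have hsM : s * M ≤ Real.log 2 := by
    have h1 : (s : ℝ) ≤ Real.log 2 / (M + 1) := by
      rw [← Real.coe_toNNReal _ hlog.le]
      exact_mod_cast min_le_right _ _
    calc s * M ≤ Real.log 2 / (M + 1) * (M + 1) := by gcongr; linarith
      _ = Real.log 2 := by field_simp
  refine ⟨s, lt_min ht (Real.toNNReal_pos.2 hlog), min_le_left _ _, fun c => ?_⟩
  let B : ℕ → Set (G ⧸ Γ) := fun m => S ^ m • A
  have hB : ∀ m, MeasurableSet (B m)ᶜ :=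
    fun m => ((isCompact_pow hS m).smul_set hA).measurableSet.compl
  let K : ℝ := Real.exp (s * (ℓ 1 + N) + c)
  have hlift : ∀ m, ∀ x ∈ B m, ∃ g : G, (g : G ⧸ Γ) = x ∧
      ENNReal.ofReal (Real.exp (ℓ.scaleAdd s c g)) ≤ ENNReal.ofReal K * 2 ^ m := by
    rintro m _ ⟨σ, hσ, y, hy, rfl⟩
    obtain ⟨l, hl, rfl⟩ := hAL hy
    refine ⟨σ * l, rfl, ?_⟩
    have h1 : ℓ (σ * l) ≤ m * M + ℓ 1 + N :=
      (ℓ.mul_le σ l).trans (add_le_add (ℓ.le_of_mem_pow hM m σ hσ) (hN ⟨l, hl, rfl⟩))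
    have h2 : ℓ.scaleAdd s c (σ * l) ≤ (s * (ℓ 1 + N) + c) + m * Real.log 2 := by
      change s * ℓ (σ * l) + c ≤ _
      have h3 := mul_le_mul_of_nonneg_left h1 s.coe_nonneg
      have h4 := mul_le_mul_of_nonneg_left hsM m.cast_nonneg
      linarith
    have h5 : Real.exp ((s * (ℓ 1 + N) + c) + m * Real.log 2) = K * 2 ^ m := by
      rw [Real.exp_add, Real.exp_nat_mul, Real.exp_log two_pos]
    refine (ENNReal.ofReal_le_ofReal ((Real.exp_le_exp.2 h2).trans_eq h5)).trans_eq ?_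
    rw [ENNReal.ofReal_mul (Real.exp_pos _).le, ENNReal.ofReal_pow zero_le_two]
    simp [K]
  refine ⟨fun x => ENNReal.ofReal K * (1 + ∑' m, (B m)ᶜ.indicator (fun _ => 2 ^ (m + 1)) x), ?_,
    fun x => ?_⟩
  · have hmeas : ∀ m, Measurable ((B m)ᶜ.indicator fun _ : G ⧸ Γ => (2 : ENNReal) ^ (m + 1)) :=
      fun m => measurable_const.indicator (hB m)
    rw [lintegral_const_mul' _ _ ENNReal.ofReal_ne_top, lintegral_add_left measurable_const,
      lintegral_tsum fun m => (hmeas m).aemeasurable]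
    refine ENNReal.mul_ne_top ENNReal.ofReal_ne_top (ENNReal.add_ne_top.2 ⟨by simp, ?_⟩)
    have hsum : Summable fun m : ℕ => 2 * D * (2 / 3 : ℝ) ^ m :=
      (summable_geometric_of_lt_one (by norm_num) (by norm_num)).mul_left _
    refine ne_top_of_le_ne_top hsum.tsum_ofReal_ne_top (ENNReal.tsum_le_tsum fun m => ?_)
    rw [lintegral_indicator_const (hB m), ← ofReal_measureReal,
      show (2 : ENNReal) ^ (m + 1) = ENNReal.ofReal (2 ^ (m + 1)) by
        rw [ENNReal.ofReal_pow zero_le_two]; simp,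
      ← ENNReal.ofReal_mul (by positivity)]
    refine ENNReal.ofReal_le_ofReal ?_
    calc (2 : ℝ) ^ (m + 1) * μ.real (B m)ᶜ ≤ 2 ^ (m + 1) * (D * (1 / 3) ^ m) := by
          gcongr
          exact hD m
      _ = 2 * D * (2 / 3) ^ m := by rw [pow_succ, div_pow, div_pow]; ring
  · by_cases hx : ∃ m, x ∈ B m
    · classical
      obtain ⟨g, hg, hgw⟩ := hlift _ x (Nat.find_spec hx)
      refine ⟨g, hg, hgw.trans ?_⟩
      dsimp only
      gcongr
      rcases hm : Nat.find hx with _ | m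
      · simp
      · have hxm : x ∈ (B m)ᶜ := Nat.find_min hx (by omega)
        refine le_add_left (le_trans ?_ (ENNReal.le_tsum m))
        rw [Set.indicator_of_mem hxm]
    · -- On the null set that the compact sets do not reach, the weight is infinite.
      obtain ⟨g, rfl⟩ := QuotientGroup.mk_surjective x
      refine ⟨g, rfl, ?_⟩
      have htop : ∑' m, (B m)ᶜ.indicator (fun _ => (2 : ENNReal) ^ (m + 1)) (g : G ⧸ Γ) = ⊤ := by
        refine top_unique ((ENNReal.tsum_const_eq_top_of_ne_zero (α := ℕ) one_ne_zero).ge.trans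
          (ENNReal.tsum_le_tsum fun m => ?_))
        rw [Set.indicator_of_mem (show (g : G ⧸ Γ) ∈ (B m)ᶜ from fun h => hx ⟨m, h⟩)]
        exact one_le_pow₀ one_le_two
      dsimp only
      rw [htop, show (1 : ENNReal) + ⊤ = ⊤ by simp, ENNReal.mul_top (by simpa using Real.exp_pos _)]
      exact le_top

/-- The restriction of a length function to a subgroup. -/
def LengthFunction.restrict (ℓ : LengthFunction G) (Γ : Subgroup G) : LengthFunction Γ where
  toFun γ := ℓ γ
  nonneg γ := ℓ.nonneg γ
  bddAbove_image K hK := by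
    have := ℓ.bddAbove_image _ (hK.image continuous_subtype_val)
    rwa [Set.image_image] at this
  inv γ := ℓ.inv γ
  mul_le γ δ := ℓ.mul_le γ δ

end Weight

/-- Strong property (T) passes from a lattice to the ambient group. -/
theorem HasStrongPropertyT.of_lattice {G : Type*} [Group G] [TopologicalSpace G]
    [IsTopologicalGroup G] [LocallyCompactSpace G] [T2Space G] [MeasurableSpace G] [BorelSpace G]
    (Γ : Subgroup G) [IsLattice Γ] (hΓ : HasStrongPropertyT Γ) : HasStrongPropertyT G := by
  let : MeasurableSpace (G ⧸ Γ) := borel _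
  have : BorelSpace (G ⧸ Γ) := ⟨rfl⟩
  obtain ⟨μ, hμ, hreg, hinv⟩ := IsLattice.exists_measure (Γ := Γ)
  have : SMulInvariantMeasure G (G ⧸ Γ) μ := ⟨fun g A hA => hinv g A hA⟩
  intro ℓ
  obtain ⟨t, ht, hproj⟩ := hΓ (ℓ.restrict Γ)
  have hle : ∀ {s : ℝ≥0} (_ : s ≤ t) (c : ℝ≥0) (γ : Γ),
      ℓ.scaleAdd s c γ ≤ (ℓ.restrict Γ).scaleAdd t c γ := fun {s} hs c γ => by
    change s * ℓ γ + c ≤ t * ℓ γ + c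
    have := ℓ.nonneg γ
    gcongr
  -- The unitary case provides the decay that controls the growth of `ℓ` over `G ⧸ Γ`.
  obtain ⟨P₁, hP₁⟩ := hproj 0
  obtain ⟨P₀, hP₀⟩ := exists_isKazhdanProjection_of_lattice (ℓ := ℓ.scaleAdd 0 0) μ
    (hle (zero_le) 0) hP₁ (w := fun _ => 1) (by simp) <| ae_of_all _ fun x => by
      obtain ⟨g, rfl⟩ := QuotientGroup.mk_surjective x
      exact ⟨g, rfl, by simp [LengthFunction.scaleAdd]⟩
  obtain ⟨s, hs, hst, hw⟩ := hP₀.exists_weight μ ℓ ht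
  refine ⟨s, hs, fun c => ?_⟩
  obtain ⟨P, hP⟩ := hproj c
  obtain ⟨w, hwint, hwℓ⟩ := hw c
  exact exists_isKazhdanProjection_of_lattice μ (hle hst c) hP hwint (ae_of_all _ hwℓ)

end StrongT

end

theorem mainTheorem9 {G : Type*} [Group G] [TopologicalSpace G] [IsTopologicalGroup G]
    [LocallyCompactSpace G] [T2Space G] [MeasurableSpace G] [BorelSpace G]
    (Γ : Subgroup G) [StrongT.IsLattice Γ] (hG : ¬ StrongT.HasStrongPropertyT G) :
    ¬ StrongT.HasStrongPropertyT Γ :=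
  fun hΓ => hG (hΓ.of_lattice Γ)
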